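/- Let $\Omega\subset\mathbb R^3$ be a bounded domain (non-empty, open, connected; in particular $\Omega$ may be simply connected with smooth boundary), let $\nu>0$, $\tau>0$, and let boundary data $f_i$ on $[0,\tau]\times\partial\Omega$ and initial data $g_i$ on $\Omega$ $(i=1,2,3)$ be given. Repeated indices are summed. Consider $$J(u_i,p,w_i,r)=\int_0^\tau\!\!\int_\Omega \mathscr L\,dx\,dt,$$ $$\mathscr L=\tfrac{\nu}{2}\Big(\tfrac{\partial u_i}{\partial x_j}\Big)^2+\tfrac12(w_i+u_i)u_j\tfrac{\partial w_i}{\partial x_j}+u_i\tfrac{\partial p}{\partial x_i}+\tfrac{u_i}{2}\tfrac{\partial w_i}{\partial t}-\tfrac{\nu}{2}\Big(\tfrac{\partial w_i}{\partial x_j}\Big)^2-\tfrac12(u_i+w_i)w_j\tfrac{\partial u_i}{\partial x_j}-w_i\tfrac{\partial r}{\partial x_i}-\tfrac{w_i}{2}\tfrac{\partial u_i}{\partial t}.$$ The admissible functions $(u_i,p,w_i,r)$ are those such that: (i) $u_i,w_i,p,r$ are continuous on $[0,\tau]\times\overline\Omega$; in $(0,\tau)\times\Omega$ the functions $u_i,w_i$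 have spatial derivatives of first and second order and a first time derivative, and $p,r$ have first spatial derivatives, all of which extend continuously to $[0,\tau]\times\overline\Omega$; (ii) $u_i=w_i=f_i$ on $[0,\tau]\times\partial\Omega$; (iii) $u_i=w_i=g_i$ in $\Omega$ at $t=0$; (iv) $u_i=w_i$ in $\Omega$ at $t=\tau$; (v) $p=r$ on $[0,\tau]\times\partial\Omega$. Admissible variations are the functions $h=(\delta u_i,\delta p,\delta w_i,\delta r)$ in the class (i)–(v) with zero data $f=g=0$. An admissible $z$ is a stationary point of $J$ if $\frac{d}{ds}J(z+sh)|_{s=0}$ exists and equals $0$ for every admissible variation $h$. No conditions on the data are needed; this includes the case $\int_{\partial\Omega}f_in_i\,dS=0$ and $\partial g_i/\partial x_i=0$. Then: 1. For every admissible $z$, $\mathscr L$ is integrable on $(0,\tau)\times\Omega$, and $s\mapsto J(z+sh)$ is differentiable at $s=0$ for every admissible variation $h$. 2. An admissible $(u_i,p,w_i,r)$ is a stationary point of $J$ if and only if it satisfies in $(0,\tau)\times\Omega$ the Euler–Lagrange system $$\tfrac{\partial u_i}{\partial x_i}=0,\qquad \tfrac{\partial w_i}{\partial x_i}=0,$$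 $$\nu\tfrac{\partial^2u_i}{\partial x_j^2}-\tfrac{\partial p}{\partial x_i}=\tfrac{\partial w_i}{\partial t}+\tfrac{u_j+w_j}{2}\Big(\tfrac{\partial w_i}{\partial x_j}+\tfrac{\partial w_j}{\partial x_i}\Big),\qquad \nu\tfrac{\partial^2w_i}{\partial x_j^2}-\tfrac{\partial r}{\partial x_i}=\tfrac{\partial u_i}{\partial t}+\tfrac{w_j+u_j}{2}\Big(\tfrac{\partial u_i}{\partial x_j}+\tfrac{\partial u_j}{\partial x_i}\Big).$$ 3. At every stationary point $(u_i-w_i)/2=0$ and $(p-r)/2=0$ on $[0,\tau]\times\overline\Omega$. 4. The stationary points are exactly the points $(v_i,q,v_i,q)$ (as functions on $[0,\tau]\times\overline\Omega$), where $v_i,q$ have the regularity (i), $v_i=f_i$ on $[0,\tau]\times\partial\Omega$, $v_i=g_i$ in $\Omega$ at $t=0$, and in $(0,\tau)\times\Omega$ the Navier–Stokes equations with pressure $q+\frac12v_j^2$ hold: $$\tfrac{\partial v_i}{\partial x_i}=0,\qquad \tfrac{\partial v_i}{\partial t}+v_j\tfrac{\partial v_i}{\partial x_j}=-\tfrac{\partial}{\partial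 x_i}\Big(q+\tfrac12v_j^2\Big)+\nu\tfrac{\partial^2v_i}{\partial x_j^2}.$$ 5. The stationary point is unique (so it exists precisely when the Navier–Stokes problem in 4 has such a solution): two stationary points have the same $u_i$ and the same $w_i$ on $[0,\tau]\times\overline\Omega$, and their $p$ and $r$ differ there only by a common function of $t$. 6. The value of $J$ at a stationary point is $0$. 7. A stationary point $z$ is neither a maximum nor a minimum of $J$, not even a local one: there are admissible variations $h,k$ such that for all sufficiently small $s\neq0$ the points $z+sh$, $z+sk$ are admissible and $J(z+sk)<J(z)<J(z+sh)$. -/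

import Mathlib

open Set Filter Topology MeasureTheory

namespace NavierStokesVP

noncomputable section

/-- Physical space `ℝ³`. -/
abbrev Space := EuclideanSpace ℝ (Fin 3)

/-- Time-dependent scalar functions `φ t x`. -/
abbrev ScalarField := ℝ → Space → ℝ

/-- Time-dependent vector functions, given by their cartesian components `u i t x`. -/
abbrev VectorField := Fin 3 → ScalarField

/-- The eight functions `(u, p, w, r)`, with their pointwise vector space structure. -/
abbrev Fields := VectorField × ScalarField × VectorField × ScalarField

abbrev Fields.u (z : Fields) : VectorField := z.1
abbrev Fields.p (z : Fields) : ScalarField := z.2.1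
abbrev Fields.w (z : Fields) : VectorField := z.2.2.1
abbrev Fields.r (z : Fields) : ScalarField := z.2.2.2

/-- The spatial partial derivative `∂φ/∂x_j`. -/
def dx (j : Fin 3) (φ : ScalarField) : ScalarField :=
  fun t x => fderiv ℝ (φ t) x (EuclideanSpace.single j 1)

/-- The time derivative `∂φ/∂t`. -/
def dt (φ : ScalarField) : ScalarField :=
  fun t x => deriv (fun s => φ s x) t

/-- The spatial Laplacian. -/
def laplacian (φ : ScalarField) : ScalarField :=
  fun t x => ∑ j, dx j (dx j φ) t x

/-- The open space-time cylinder `(0, τ) × Ω`. -/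
def openCylinder (Ω : Set Space) (τ : ℝ) : Set (ℝ × Space) := Ioo 0 τ ×ˢ Ω

/-- The closed space-time cylinder `[0, τ] × (Ω ∪ ∂Ω)`. -/
def closedCylinder (Ω : Set Space) (τ : ℝ) : Set (ℝ × Space) := Icc 0 τ ×ˢ closure Ω

/-- `φ`, considered on the open cylinder, extends continuously to the closed cylinder. -/
def ExtendsContinuously (Ω : Set Space) (τ : ℝ) (φ : ScalarField) : Prop :=
  ∃ G : ℝ × Space → ℝ, ContinuousOn G (closedCylinder Ω τ) ∧
    EqOn (fun y => φ y.1 y.2) G (openCylinder Ω τ)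

/-- `φ` is continuous on the closed cylinder and has first order spatial derivatives, continuous
up to the boundary of the cylinder. -/
structure PressureRegular (Ω : Set Space) (τ : ℝ) (φ : ScalarField) : Prop where
  continuousOn : ContinuousOn (fun y : ℝ × Space => φ y.1 y.2) (closedCylinder Ω τ)
  contDiffOn : ∀ t ∈ Ioo 0 τ, ContDiffOn ℝ 1 (φ t) Ω
  extends_dx : ∀ j, ExtendsContinuously Ω τ (dx j φ)

/-- `φ` is continuous on the closed cylinder and has spatial derivatives of first and second order
and a first order time derivative, continuous up to the boundary of the cylinder. -/
structure VelocityRegular (Ω : Set Space) (τ : ℝ) (φ : ScalarField) : Prop where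
  continuousOn : ContinuousOn (fun y : ℝ × Space => φ y.1 y.2) (closedCylinder Ω τ)
  contDiffOn : ∀ t ∈ Ioo 0 τ, ContDiffOn ℝ 2 (φ t) Ω
  differentiableAt : ∀ t ∈ Ioo 0 τ, ∀ x ∈ Ω, DifferentiableAt ℝ (fun s => φ s x) t
  extends_dx : ∀ j, ExtendsContinuously Ω τ (dx j φ)
  extends_dxdx : ∀ j k, ExtendsContinuously Ω τ (dx j (dx k φ))
  extends_dt : ExtendsContinuously Ω τ (dt φ)

/-- The Lagrangian `ℒ(u, p, w, r)` with kinematic viscosity `ν`; repeated indices are summed. -/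
def lagrangian (ν : ℝ) (z : Fields) : ScalarField := fun t x =>
  (∑ i, ∑ j,
    (ν / 2 * (dx j (z.u i) t x) ^ 2
      + 1 / 2 * (z.w i t x + z.u i t x) * z.u j t x * dx j (z.w i) t x))
  + (∑ i, (z.u i t x * dx i z.p t x + z.u i t x / 2 * dt (z.w i) t x))
  - (∑ i, ∑ j,
    (ν / 2 * (dx j (z.w i) t x) ^ 2
      + 1 / 2 * (z.u i t x + z.w i t x) * z.w j t x * dx j (z.u i) t x))
  - (∑ i, (z.w i t x * dx i z.r t x + z.w i t x / 2 * dt (z.u i) t x))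

/-- The functional `J(u, p, w, r) = ∫₀^τ ∫_Ω ℒ(u, p, w, r) dx dt`. -/
def J (Ω : Set Space) (ν τ : ℝ) (z : Fields) : ℝ :=
  ∫ t in (0 : ℝ)..τ, ∫ x in Ω, lagrangian ν z t x

/-- The class of admissible functions with boundary values `f` and initial values `g`. No
condition is imposed on the data: zero flux of `f` and `div g = 0` are not needed. -/
structure Admissible (Ω : Set Space) (τ : ℝ) (f : VectorField) (g : Fin 3 → Space → ℝ)
    (z : Fields) : Prop where
  regular_u : ∀ i, VelocityRegular Ω τ (z.u i)
  regular_w : ∀ i, VelocityRegular Ω τ (z.w i)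
  regular_p : PressureRegular Ω τ z.p
  regular_r : PressureRegular Ω τ z.r
  boundary_u : ∀ i, ∀ t ∈ Icc 0 τ, ∀ x ∈ frontier Ω, z.u i t x = f i t x
  boundary_w : ∀ i, ∀ t ∈ Icc 0 τ, ∀ x ∈ frontier Ω, z.w i t x = f i t x
  initial_u : ∀ i, ∀ x ∈ Ω, z.u i 0 x = g i x
  initial_w : ∀ i, ∀ x ∈ Ω, z.w i 0 x = g i x
  final : ∀ i, ∀ x ∈ Ω, z.u i τ x = z.w i τ x
  boundary_pressure : ∀ t ∈ Icc 0 τ, ∀ x ∈ frontier Ω, z.p t x = z.r t x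

/-- Admissible variations `(δu, δp, δw, δr)`: the differences of admissible functions, that is,
the class of admissible functions with zero boundary and initial values. -/
def AdmissibleVariation (Ω : Set Space) (τ : ℝ) (h : Fields) : Prop :=
  Admissible Ω τ 0 0 h

/-- `z` is a stationary point of `J` in the admissible class: the first variation
`δJ = d/ds J(z + s h)` at `s = 0` exists and vanishes for every admissible variation `h`. -/
def IsStationaryPoint (Ω : Set Space) (ν τ : ℝ) (f : VectorField) (g : Fin 3 → Space → ℝ)
    (z : Fields) : Prop :=
  Admissible Ω τ f g z ∧
    ∀ h, AdmissibleVariation Ω τ h → HasDerivAt (fun s : ℝ => J Ω ν τ (z + s • h)) 0 0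

/-- The Euler-Lagrange equations of `J` in `(0, τ) × Ω`. -/
structure EulerLagrange (Ω : Set Space) (ν τ : ℝ) (z : Fields) : Prop where
  eq_p : ∀ t ∈ Ioo 0 τ, ∀ x ∈ Ω, ∑ i, dx i (z.u i) t x = 0
  eq_r : ∀ t ∈ Ioo 0 τ, ∀ x ∈ Ω, ∑ i, dx i (z.w i) t x = 0
  eq_u : ∀ i, ∀ t ∈ Ioo 0 τ, ∀ x ∈ Ω,
    ν * laplacian (z.u i) t x - dx i z.p t x =
      dt (z.w i) t x
        + ∑ j, (z.u j t x + z.w j t x) / 2 * (dx j (z.w i) t x + dx i (z.w j) t x)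
  eq_w : ∀ i, ∀ t ∈ Ioo 0 τ, ∀ x ∈ Ω,
    ν * laplacian (z.w i) t x - dx i z.r t x =
      dt (z.u i) t x
        + ∑ j, (z.w j t x + z.u j t x) / 2 * (dx j (z.u i) t x + dx i (z.u j) t x)

/-- `(v, q)` is a classical solution, in the regularity class of the admissible functions, of the
incompressible Navier-Stokes equations without external force, with pressure `q + |v|²/2`,
boundary values `f` and initial values `g`. -/
structure IsNavierStokesSolution (Ω : Set Space) (ν τ : ℝ) (f : VectorField)
    (g : Fin 3 → Space → ℝ) (v : VectorField) (q : ScalarField) : Prop where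
  regular_v : ∀ i, VelocityRegular Ω τ (v i)
  regular_q : PressureRegular Ω τ q
  incompressible : ∀ t ∈ Ioo 0 τ, ∀ x ∈ Ω, ∑ i, dx i (v i) t x = 0
  momentum : ∀ i, ∀ t ∈ Ioo 0 τ, ∀ x ∈ Ω,
    dt (v i) t x + ∑ j, v j t x * dx j (v i) t x =
      - dx i (fun s y => q s y + 1 / 2 * ∑ j, (v j s y) ^ 2) t x + ν * laplacian (v i) t x
  boundary : ∀ i, ∀ t ∈ Icc 0 τ, ∀ x ∈ frontier Ω, v i t x = f i t x
  initial : ∀ i, ∀ x ∈ Ω, v i 0 x = g i x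

end

end NavierStokesVP

open NavierStokesVP

namespace NavierStokesVP

noncomputable section

/-! The Lagrangian is antisymmetric under the exchange `(u, p) ↔ (w, r)` and cubic in the fields.
Hence `J (z + s • h)` is exactly a cubic polynomial in `s` (`J_add_smul`), and stationarity means
that its linear coefficient vanishes. Integration by parts turns this coefficient into the integral
of the variation paired with the Euler–Lagrange residuals (`firstVariation_eq`); testing with
functions supported in the open cylinder isolates each residual.

No regularity of the boundary is available, so integration by parts is proved on an arbitrary
bounded open set when one factor vanishes on the frontier (`setIntegral_fderiv_mul_add`). That
factor is truncated near its zero set, which makes its support compact, and the truncation is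
removed by dominated convergence.

In the Euler–Lagrange system the time derivatives are crossed: the equation with the Laplacian of
`u` contains the time derivative of `w`, and conversely. Subtraction therefore gives for `d = u - w`
a linear perturbed Stokes system which is parabolic in reversed time, with `d = 0` on the boundary
and at `t = τ`. The energy estimate and Grönwall's inequality, run backward from `τ`, force `d = 0`
(`EulerLagrange.u_eq_w`). Then `p - r` has zero gradient and zero boundary values, so it vanishes as
well. On the diagonal both momentum equations become Navier–Stokes, because `v_j ∂_i v_j` is the
gradient of `|v|²/2`. Uniqueness is the same energy estimate run forward, and the value of `J` is
zero by antisymmetry.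

For the absence of extrema, the variation `δu = (∂₁θ, 0, 0)`, `δp = c θ`, `δw = 0`, `δr = 0` has no
cubic term, and its quadratic coefficient is affine in `c` with slope `∫ |∂₁θ|² > 0`; so the
coefficient takes every real value. -/

theorem isCompact_superlevel {E : Type*} [NormedAddCommGroup E] [NormedSpace ℝ E]
    [FiniteDimensional ℝ E] {U : Set E} {φ : E → ℝ} (hUb : Bornology.IsBounded U)
    (hφ : ContinuousOn φ (closure U)) (ε : ℝ) : IsCompact {x ∈ closure U | ε ≤ |φ x|} := by
  have hcl : IsCompact (closure U) := hUb.isCompact_closure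
  have : {x ∈ closure U | ε ≤ |φ x|} = closure U ∩ (fun x => |φ x|) ⁻¹' Ici ε := rfl
  rw [this]
  exact hcl.of_isClosed_subset (hφ.abs.preimage_isClosed_of_isClosed isClosed_closure isClosed_Ici)
    inter_subset_left

theorem fderiv_mul_apply {E : Type*} [NormedAddCommGroup E] [NormedSpace ℝ E] {φ ψ : E → ℝ}
    {x v : E} (h1 : DifferentiableAt ℝ φ x) (h2 : DifferentiableAt ℝ ψ x) :
    fderiv ℝ (fun y => φ y * ψ y) x v = fderiv ℝ φ x v * ψ x + φ x * fderiv ℝ ψ x v := by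
  rw [fderiv_fun_mul h1 h2]
  simp
  ring

theorem continuousOn_fderiv_apply {E : Type*} [NormedAddCommGroup E] [NormedSpace ℝ E]
    {U : Set E} {φ : E → ℝ} (hU : IsOpen U) (h : ContDiffOn ℝ 1 φ U) (v : E) :
    ContinuousOn (fun x => fderiv ℝ φ x v) U :=
  (h.continuousOn_fderiv_of_isOpen hU le_rfl).clm_apply continuousOn_const

/-! ### Integration by parts on bounded open sets with arbitrary boundary. -/

section IntegrationByParts

variable {E : Type*} [NormedAddCommGroup E] [NormedSpace ℝ E] [FiniteDimensional ℝ E]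
  [MeasurableSpace E] [BorelSpace E] {μ : Measure E} [μ.IsAddHaarMeasure]

/-- The integral of a directional derivative of a `C¹` function with compact support vanishes. -/
theorem integral_fderiv_apply_eq_zero {G : E → ℝ} (hG : ContDiff ℝ 1 G)
    (hc : HasCompactSupport G) (v : E) : ∫ x, fderiv ℝ G x v ∂μ = 0 := by
  have h1 : Integrable (fun x => fderiv ℝ G x v) μ := by
    refine Continuous.integrable_of_hasCompactSupport ?_ ?_
    · exact (hG.continuous_fderiv one_ne_zero).clm_apply continuous_const
    · exact (hc.fderiv_apply ℝ v)
  have h2 : Integrable G μ := hG.continuous.integrable_of_hasCompactSupport hc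
  have := integral_mul_fderiv_eq_neg_fderiv_mul_of_integrable (μ := μ) (f := fun _ : E => (1 : ℝ))
    (g := G) (v := v) (by simp) (by simpa using h1) (by simpa using h2)
    (fun x _ => by simp) (fun x _ => (hG.differentiable one_ne_zero) x)
  simpa using this

/-- The integral over an open set of a directional derivative of a `C¹` function vanishing outside
a compact subset. -/
theorem setIntegral_fderiv_apply_eq_zero {U K : Set E} (hU : IsOpen U) (hK : IsCompact K)
    (hKU : K ⊆ U) {G : E → ℝ} (hG : ContDiffOn ℝ 1 G U) (hG0 : ∀ x ∈ U, x ∉ K → G x = 0) (v : E) :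
    ∫ x in U, fderiv ℝ G x v ∂μ = 0 := by
  classical
  set F : E → ℝ := U.indicator G with hF
  have hFK : ∀ x ∉ K, F x = 0 := by
    intro x hx
    by_cases hxU : x ∈ U
    · simp [hF, hxU, hG0 x hxU hx]
    · simp [hF, hxU]
  have hin : ∀ x ∈ U, F =ᶠ[𝓝 x] G := fun x hx => by
    filter_upwards [hU.mem_nhds hx] with y hy
    simp [hF, hy]
  have hout : ∀ x ∉ K, F =ᶠ[𝓝 x] fun _ => 0 := fun x hx => by
    filter_upwards [hK.isClosed.isOpen_compl.mem_nhds hx] with y hy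
    exact hFK y hy
  -- The open sets `U` and `Kᶜ` cover the space; the extension by zero equals `G` on the first and
  -- `0` on the second, hence is globally `C¹`.
  have hC : ContDiff ℝ 1 F := by
    rw [contDiff_iff_contDiffAt]
    intro x
    by_cases hx : x ∈ K
    · exact (hG.contDiffAt (hU.mem_nhds (hKU hx))).congr_of_eventuallyEq (hin x (hKU hx))
    · exact contDiffAt_const.congr_of_eventuallyEq (hout x hx)
  have h0 := integral_fderiv_apply_eq_zero (μ := μ) hC (HasCompactSupport.intro hK hFK) v
  rw [← setIntegral_eq_integral_of_forall_compl_eq_zero (s := U)] at h0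
  · rw [← h0]
    refine setIntegral_congr_fun hU.measurableSet fun x hx => ?_
    simp only [(hin x hx).fderiv_eq]
  · intro x hx
    rw [(hout x fun h => hx (hKU h)).fderiv_eq]
    simp

/-- A `C¹` truncation of the identity near zero. -/
theorem exists_truncation : ∃ (θ : ℝ → ℝ) (M : ℝ), ContDiff ℝ 1 θ ∧ (∀ y, |y| ≤ 1 → θ y = 0) ∧
    (∀ y, 2 ≤ |y| → θ y = y) ∧ (∀ y, |θ y| ≤ |y|) ∧ ∀ y, |deriv θ y| ≤ M := by
  -- The cut-off factor is `0` when `y ^ 2 ≤ 1` and `1` when `y ^ 2 ≥ 2`, in particular when `2 ≤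
  -- |y|`.
  set θ : ℝ → ℝ := fun y => Real.smoothTransition (y ^ 2 - 1) * y with hθ
  have hsm : ContDiff ℝ 1 θ :=
    ((Real.smoothTransition.contDiff).comp ((contDiff_id.pow 2).sub contDiff_const)).mul contDiff_id
  have htwo : ∀ y, 2 ≤ |y| → θ y = y := fun y hy => by
    have : Real.smoothTransition (y ^ 2 - 1) = 1 :=
      Real.smoothTransition.one_of_one_le (by nlinarith [sq_abs y])
    simp [hθ, this]
  have hd : Continuous (deriv θ) := hsm.continuous_deriv le_rfl
  obtain ⟨M, hM⟩ := (isCompact_Icc (a := (-3 : ℝ)) (b := 3)).exists_bound_of_continuousOn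
    hd.continuousOn
  refine ⟨θ, max M 1, hsm, fun y hy => ?_, htwo, fun y => ?_, fun y => ?_⟩
  · have : Real.smoothTransition (y ^ 2 - 1) = 0 :=
      Real.smoothTransition.zero_of_nonpos (by nlinarith [sq_abs y, abs_nonneg y])
    simp [hθ, this]
  · rw [hθ, abs_mul, abs_of_nonneg (Real.smoothTransition.nonneg _)]
    exact mul_le_of_le_one_left (abs_nonneg _) (Real.smoothTransition.le_one _)
  -- Beyond `3` the point has a whole neighbourhood in `2 < |z|`, where `θ` is the identity and its
  -- derivative is `1`; compactness bounds the rest.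
  · by_cases hy : |y| ≤ 3
    · exact (hM y (abs_le.mp hy)).trans (le_max_left _ _)
    · have : θ =ᶠ[𝓝 y] id := by
        filter_upwards [(isOpen_lt continuous_const continuous_abs).mem_nhds
          (show (2 : ℝ) < |y| by linarith)] with z hz
        exact htwo z (le_of_lt hz)
      rw [this.deriv_eq]
      simp

variable {U : Set E} {φ ψ : E → ℝ} {v : E} {C : ℝ}

/-- Replace `φ` by `θ (c φ) / c` with `c → ∞`. This vanishes where `|φ| < 1 / c`, and the remaining
set is compact and avoids the frontier because `φ = 0` there, so the compactly supported case
applies. The derivative `θ' (c φ) dφ` is bounded uniformly in `c` and tends to `dφ` where `φ ≠ 0`,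
but to `0` where `φ = 0`; this produces the indicator. -/
theorem setIntegral_truncated_parts (hU : IsOpen U) (hUb : Bornology.IsBounded U)
    (hφc : ContinuousOn φ (closure U)) (hφ0 : ∀ x ∈ frontier U, φ x = 0)
    (hφ : ContDiffOn ℝ 1 φ U) (hψ : ContDiffOn ℝ 1 ψ U)
    (hφb : ∀ x ∈ U, |φ x| ≤ C) (hψb : ∀ x ∈ U, |ψ x| ≤ C)
    (hdφ : ∀ x ∈ U, |fderiv ℝ φ x v| ≤ C) (hdψ : ∀ x ∈ U, |fderiv ℝ ψ x v| ≤ C) :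
    ∫ x in U, ({x | φ x ≠ 0}.indicator (fun x => fderiv ℝ φ x v * ψ x) x + φ x * fderiv ℝ ψ x v) ∂μ
      = 0 := by
  obtain ⟨θ, M, hθ, hθ1, hθ2, hθ3, hθM⟩ := exists_truncation
  have hUfin : μ U < ⊤ := hUb.measure_lt_top
  have : IsFiniteMeasure (μ.restrict U) := ⟨by simpa using hUfin⟩
  -- The shift by one keeps the scale positive at `n = 0`.
  set c : ℕ → ℝ := fun n => (n : ℝ) + 1 with hc
  have hcpos : ∀ n, 0 < c n := fun n => by positivity
  have hM : 0 ≤ M := (abs_nonneg _).trans (hθM 0)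
  have hdif : ∀ x ∈ U, DifferentiableAt ℝ φ x := fun x hx =>
    (hφ.contDiffAt (hU.mem_nhds hx)).differentiableAt one_ne_zero
  have hdifψ : ∀ x ∈ U, DifferentiableAt ℝ ψ x := fun x hx =>
    (hψ.contDiffAt (hU.mem_nhds hx)).differentiableAt one_ne_zero
  set F : ℕ → E → ℝ := fun n x =>
    deriv θ (c n * φ x) * fderiv ℝ φ x v * ψ x + (c n)⁻¹ * θ (c n * φ x) * fderiv ℝ ψ x v with hF
  have key : ∀ n, ∫ x in U, F n x ∂μ = 0 := by
    intro n
    have hcn := hcpos n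
    have hG : ContDiffOn ℝ 1 (fun x => (c n)⁻¹ * θ (c n * φ x)) U :=
      contDiffOn_const.mul (hθ.comp_contDiffOn (contDiffOn_const.mul hφ))
    have := setIntegral_fderiv_apply_eq_zero (μ := μ) hU
      (isCompact_superlevel hUb hφc (c n)⁻¹) (v := v) ?_ (hG.mul hψ) ?_
    · rw [← this]
      refine setIntegral_congr_fun hU.measurableSet fun x hx => ?_
      have hd : HasFDerivAt (fun x => (c n)⁻¹ * θ (c n * φ x))
          ((c n)⁻¹ • (deriv θ (c n * φ x) • (c n • fderiv ℝ φ x))) x :=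
        (((hθ.differentiable one_ne_zero _).hasDerivAt.comp_hasFDerivAt x
          ((hdif x hx).hasFDerivAt.const_mul (c n)))).const_mul _
      have h2 := fderiv_mul_apply (v := v) hd.differentiableAt (hdifψ x hx)
      simp only [hF]
      rw [h2, hd.fderiv]
      simp only [_root_.smul_apply, smul_eq_mul]
      field_simp
    · rintro x ⟨hx, hx'⟩
      by_contra hxU
      have : x ∈ frontier U := ⟨hx, by rwa [hU.interior_eq]⟩
      rw [hφ0 x this, abs_zero] at hx'
      exact absurd hx' (not_le.mpr (inv_pos.mpr hcn))
    · intro x hx hx'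
      have h1 : |φ x| < (c n)⁻¹ := by
        by_contra h
        exact hx' ⟨subset_closure hx, not_lt.mp h⟩
      have h2 : |c n * φ x| ≤ 1 := by
        rw [abs_mul, abs_of_pos hcn]
        calc c n * |φ x| ≤ c n * (c n)⁻¹ := by gcongr
          _ = 1 := mul_inv_cancel₀ hcn.ne'
      simp [hθ1 _ h2]
  have hφcU : ContinuousOn φ U := hφ.continuousOn
  have hψcU : ContinuousOn ψ U := hψ.continuousOn
  have hdφc := continuousOn_fderiv_apply hU hφ v
  have hdψc := continuousOn_fderiv_apply hU hψ v
  have lim := tendsto_integral_of_dominated_convergence (μ := μ.restrict U) (F := F)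
    (f := fun x => {x | φ x ≠ 0}.indicator (fun x => fderiv ℝ φ x v * ψ x) x
      + φ x * fderiv ℝ ψ x v)
    (fun _ => M * C * C + C * C) ?_ (integrable_const _) ?_ ?_
  · simp only [key] at lim
    exact (tendsto_nhds_unique lim tendsto_const_nhds)
  · intro n
    refine ContinuousOn.aestronglyMeasurable ?_ hU.measurableSet
    have hcφ : ContinuousOn (fun x => c n * φ x) U := continuousOn_const.mul hφcU
    exact ((((hθ.continuous_deriv le_rfl).comp_continuousOn hcφ).mul hdφc).mul hψcU).add
      ((continuousOn_const.mul (hθ.continuous.comp_continuousOn hcφ)).mul hdψc)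
  · intro n
    refine (ae_restrict_iff' hU.measurableSet).mpr (.of_forall fun x hx => ?_)
    have hC : 0 ≤ C := (abs_nonneg _).trans (hφb x hx)
    have h3 : |(c n)⁻¹ * θ (c n * φ x)| ≤ C := by
      rw [abs_mul, abs_of_pos (inv_pos.mpr (hcpos n))]
      calc (c n)⁻¹ * |θ (c n * φ x)| ≤ (c n)⁻¹ * |c n * φ x| :=
            mul_le_mul_of_nonneg_left (hθ3 _) (inv_pos.mpr (hcpos n)).le
        _ = |φ x| := by
            rw [abs_mul, abs_of_pos (hcpos n), inv_mul_cancel_left₀ (hcpos n).ne']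
        _ ≤ C := hφb x hx
    rw [Real.norm_eq_abs]
    refine (abs_add_le _ _).trans (add_le_add ?_ ?_)
    · rw [abs_mul, abs_mul]
      exact mul_le_mul (mul_le_mul (hθM _) (hdφ x hx) (abs_nonneg _) hM) (hψb x hx)
        (abs_nonneg _) (by positivity)
    · rw [abs_mul]
      exact mul_le_mul h3 (hdψ x hx) (abs_nonneg _) hC
  · refine (ae_restrict_iff' hU.measurableSet).mpr (.of_forall fun x hx => ?_)
    by_cases h0 : φ x = 0
    · refine tendsto_const_nhds.congr fun n => ?_
      have e1 : deriv θ 0 = 0 := by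
        have : θ =ᶠ[𝓝 0] fun _ => 0 := by
          filter_upwards [(isOpen_lt continuous_abs continuous_const).mem_nhds
            (show |(0 : ℝ)| < 1 by simp)] with z hz
          exact hθ1 z (le_of_lt hz)
        rw [this.deriv_eq]
        simp
      simp [hF, h0, e1, hθ1 0 (by simp)]
    -- Once `c n * |φ x| > 2` the truncation is the identity near the point, so the sequence is
    -- eventually constant.
    · obtain ⟨N, hN⟩ := exists_nat_gt (2 / |φ x|)
      have hpos : 0 < |φ x| := abs_pos.mpr h0
      refine tendsto_const_nhds.congr' ?_
      filter_upwards [eventually_ge_atTop N] with n hn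
      have h2 : 2 < |c n * φ x| := by
        rw [abs_mul, abs_of_pos (hcpos n)]
        have : 2 / |φ x| < c n := hN.trans (by
          have : (N : ℝ) ≤ n := by exact_mod_cast hn
          simp only [hc]; linarith)
        exact (div_lt_iff₀ hpos).mp this
      have e1 : deriv θ (c n * φ x) = 1 := by
        have : θ =ᶠ[𝓝 (c n * φ x)] id := by
          filter_upwards [(isOpen_lt continuous_const continuous_abs).mem_nhds h2] with z hz
          exact hθ2 z (le_of_lt hz)
        rw [this.deriv_eq]
        simp
      simp only [hF, e1, hθ2 _ h2.le]
      rw [indicator_of_mem (show x ∈ {x | φ x ≠ 0} from h0)]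
      rw [inv_mul_cancel_left₀ (hcpos n).ne']
      ring

theorem integrableOn_of_continuousOn_bounded (hU : IsOpen U) (hUb : Bornology.IsBounded U)
    {F : E → ℝ} (hF : ContinuousOn F U) {D : ℝ} (hD : ∀ x ∈ U, |F x| ≤ D) : IntegrableOn F U μ :=
  IntegrableOn.of_bound hUb.measure_lt_top (hF.aestronglyMeasurable hU.measurableSet) D
    ((ae_restrict_iff' hU.measurableSet).mpr (.of_forall hD))

/-- The derivative of a function vanishes almost everywhere on its zero set. -/
theorem ae_fderiv_eq_zero_of_eq_zero (hU : IsOpen U) (hUb : Bornology.IsBounded U)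
    (hφc : ContinuousOn φ (closure U)) (hφ0 : ∀ x ∈ frontier U, φ x = 0)
    (hφ : ContDiffOn ℝ 1 φ U) (hφb : ∀ x ∈ U, |φ x| ≤ C) (hdφ : ∀ x ∈ U, |fderiv ℝ φ x v| ≤ C) :
    ∀ᵐ x ∂μ, x ∈ U → {x | φ x = 0}.indicator (fun x => fderiv ℝ φ x v) x = 0 := by
  have hdφc := continuousOn_fderiv_apply hU hφ v
  have hdi : IntegrableOn (fun x => fderiv ℝ φ x v) U μ :=
    integrableOn_of_continuousOn_bounded hU hUb hdφc hdφ
  have hmeas : ∀ S : Set ℝ, MeasurableSet S → NullMeasurableSet (φ ⁻¹' S) (μ.restrict U) :=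
    fun S hS => (hφ.continuousOn.aestronglyMeasurable hU.measurableSet).aemeasurable.nullMeasurable hS
  have hm0 : NullMeasurableSet {x | φ x = 0} (μ.restrict U) := hmeas {0} (measurableSet_singleton 0)
  have hm1 : NullMeasurableSet {x | φ x ≠ 0} (μ.restrict U) := hm0.compl
  have hint : IntegrableOn ({x | φ x = 0}.indicator (fun x => fderiv ℝ φ x v)) U μ :=
    Integrable.indicator₀ hdi hm0
  refine hU.ae_eq_zero_of_integral_contDiff_smul_eq_zero hint.locallyIntegrableOn ?_
  intro χ hχ hχc hχU
  have hχ1 : ContDiff ℝ 1 χ := hχ.of_le (by norm_cast)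
  obtain ⟨B, hB⟩ := hχ1.continuous.bounded_above_of_compact_support hχc
  obtain ⟨B', hB'⟩ := ((hχ1.continuous_fderiv one_ne_zero).clm_apply
    (continuous_const (y := v))).bounded_above_of_compact_support (hχc.fderiv_apply ℝ v)
  set D := max C (max B B')
  have d1 : C ≤ D := le_max_left _ _
  have d2 : B ≤ D := (le_max_left _ _).trans (le_max_right _ _)
  have d3 : B' ≤ D := (le_max_right _ _).trans (le_max_right _ _)
  -- Against a test function `χ` both identities hold: the truncated one, and the exact one `t2`,
  -- where the compact support of `χ` makes truncation unnecessary.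
  have t1 := setIntegral_truncated_parts (μ := μ) (ψ := χ) (C := D) hU hUb hφc hφ0 hφ
    hχ1.contDiffOn (fun x hx => (hφb x hx).trans d1) (fun x _ => (hB x).trans d2)
    (fun x hx => (hdφ x hx).trans d1) (fun x _ => (hB' x).trans d3)
  have t2 := setIntegral_fderiv_apply_eq_zero (μ := μ) (v := v) hU hχc.isCompact hχU
    (hφ.mul hχ1.contDiffOn)
    (fun x _ hx => by simp [image_eq_zero_of_notMem_tsupport hx])
  have e2 : ∫ x in U, (fderiv ℝ φ x v * χ x + φ x * fderiv ℝ χ x v) ∂μ = 0 := by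
    rw [← t2]
    refine setIntegral_congr_fun hU.measurableSet fun x hx => ?_
    exact (fderiv_mul_apply ((hφ.contDiffAt (hU.mem_nhds hx)).differentiableAt one_ne_zero)
      (hχ1.differentiable one_ne_zero x)).symm
  have hi1 : IntegrableOn (fun x => fderiv ℝ φ x v * χ x) U μ :=
    Integrable.mul_bdd (c := B) hdi hχ1.continuous.aestronglyMeasurable (.of_forall hB)
  have hi2 : IntegrableOn (fun x => φ x * fderiv ℝ χ x v) U μ :=
    Integrable.mul_bdd (c := B') (integrableOn_of_continuousOn_bounded hU hUb hφ.continuousOn hφb)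
      ((hχ1.continuous_fderiv one_ne_zero).clm_apply continuous_const).aestronglyMeasurable
      (.of_forall hB')
  have hi3 : IntegrableOn ({x | φ x ≠ 0}.indicator (fun x => fderiv ℝ φ x v * χ x)) U μ :=
    Integrable.indicator₀ hi1 hm1
  -- In the difference of the two identities the terms `φ dχ` cancel, leaving the integral of `dφ ·
  -- χ` over the zero set of `φ`.
  have e3 := integral_sub (hi1.add hi2) (hi3.add hi2)
  simp only [Pi.add_apply] at e3
  rw [e2, t1, sub_zero] at e3
  rw [← setIntegral_eq_integral_of_forall_compl_eq_zero (s := U)]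
  · refine Eq.trans (integral_congr_ae (.of_forall fun x => ?_)) e3
    by_cases h : φ x = 0 <;> simp [h, mul_comm]
  · intro x hx
    rw [image_eq_zero_of_notMem_tsupport fun h => hx (hχU h)]
    simp

/-- Integration by parts on an arbitrary bounded open set, one factor vanishing on the boundary. -/
theorem setIntegral_fderiv_mul_add (hU : IsOpen U) (hUb : Bornology.IsBounded U)
    (hφc : ContinuousOn φ (closure U)) (hφ0 : ∀ x ∈ frontier U, φ x = 0)
    (hφ : ContDiffOn ℝ 1 φ U) (hψ : ContDiffOn ℝ 1 ψ U)
    (hφb : ∀ x ∈ U, |φ x| ≤ C) (hψb : ∀ x ∈ U, |ψ x| ≤ C)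
    (hdφ : ∀ x ∈ U, |fderiv ℝ φ x v| ≤ C) (hdψ : ∀ x ∈ U, |fderiv ℝ ψ x v| ≤ C) :
    ∫ x in U, (fderiv ℝ φ x v * ψ x + φ x * fderiv ℝ ψ x v) ∂μ = 0 := by
  rw [← setIntegral_truncated_parts (μ := μ) hU hUb hφc hφ0 hφ hψ hφb hψb hdφ hdψ]
  refine integral_congr_ae ?_
  refine (ae_restrict_iff' hU.measurableSet).mpr ?_
  filter_upwards [ae_fderiv_eq_zero_of_eq_zero (μ := μ) hU hUb hφc hφ0 hφ hφb hdφ] with x hx hxU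
  specialize hx hxU
  by_cases h : φ x = 0
  · rw [indicator_of_mem (show x ∈ {x | φ x = 0} from h)] at hx
    simp [h, hx]
  · rw [indicator_of_mem (show x ∈ {x | φ x ≠ 0} from h)]

end IntegrationByParts

/-! ### Calculus of fields on the space-time cylinder. -/

section Cylinder

variable {Ω : Set Space} {τ : ℝ} {φ ψ : ScalarField}

theorem isOpen_openCylinder (hΩ : IsOpen Ω) : IsOpen (openCylinder Ω τ) := isOpen_Ioo.prod hΩ

theorem openCylinder_subset_closedCylinder : openCylinder Ω τ ⊆ closedCylinder Ω τ :=
  prod_mono Ioo_subset_Icc_self subset_closure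

theorem isCompact_closedCylinder (hb : Bornology.IsBounded Ω) : IsCompact (closedCylinder Ω τ) :=
  isCompact_Icc.prod hb.isCompact_closure

theorem closedCylinder_subset_closure (hτ : 0 < τ) :
    closedCylinder Ω τ ⊆ closure (openCylinder Ω τ) := by
  rw [openCylinder, closure_prod_eq, closure_Ioo hτ.ne, closedCylinder]

namespace ExtendsContinuously

theorem of_continuousOn (h : ContinuousOn (fun y : ℝ × Space => φ y.1 y.2) (closedCylinder Ω τ)) :
    ExtendsContinuously Ω τ φ := ⟨_, h, fun _ _ => rfl⟩

theorem congr (h : ExtendsContinuously Ω τ φ) (e : ∀ t ∈ Ioo 0 τ, ∀ x ∈ Ω, ψ t x = φ t x) :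
    ExtendsContinuously Ω τ ψ := by
  obtain ⟨G, hG, hφ⟩ := h
  exact ⟨G, hG, fun y hy => (e y.1 hy.1 y.2 hy.2).trans (hφ hy)⟩

theorem const (c : ℝ) : ExtendsContinuously Ω τ fun _ _ => c := of_continuousOn continuousOn_const

theorem add (h : ExtendsContinuously Ω τ φ) (h' : ExtendsContinuously Ω τ ψ) :
    ExtendsContinuously Ω τ fun t x => φ t x + ψ t x := by
  obtain ⟨G, hG, e⟩ := h
  obtain ⟨G', hG', e'⟩ := h'
  exact ⟨_, hG.add hG', fun y hy => congrArg₂ (· + ·) (e hy) (e' hy)⟩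

theorem sub (h : ExtendsContinuously Ω τ φ) (h' : ExtendsContinuously Ω τ ψ) :
    ExtendsContinuously Ω τ fun t x => φ t x - ψ t x := by
  obtain ⟨G, hG, e⟩ := h
  obtain ⟨G', hG', e'⟩ := h'
  exact ⟨_, hG.sub hG', fun y hy => congrArg₂ (· - ·) (e hy) (e' hy)⟩

theorem mul (h : ExtendsContinuously Ω τ φ) (h' : ExtendsContinuously Ω τ ψ) :
    ExtendsContinuously Ω τ fun t x => φ t x * ψ t x := by
  obtain ⟨G, hG, e⟩ := h
  obtain ⟨G', hG', e'⟩ := h'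
  exact ⟨_, hG.mul hG', fun y hy => congrArg₂ (· * ·) (e hy) (e' hy)⟩

theorem pow (h : ExtendsContinuously Ω τ φ) (n : ℕ) :
    ExtendsContinuously Ω τ fun t x => φ t x ^ n := by
  obtain ⟨G, hG, e⟩ := h
  exact ⟨_, hG.pow n, fun y hy => congrArg (· ^ n) (e hy)⟩

theorem div_const (h : ExtendsContinuously Ω τ φ) (c : ℝ) :
    ExtendsContinuously Ω τ fun t x => φ t x / c := by
  obtain ⟨G, hG, e⟩ := h
  exact ⟨_, hG.div_const c, fun y hy => congrArg (· / c) (e hy)⟩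

theorem sum {ι : Type*} {s : Finset ι} {Φ : ι → ScalarField}
    (h : ∀ i, ExtendsContinuously Ω τ (Φ i)) :
    ExtendsContinuously Ω τ fun t x => ∑ i ∈ s, Φ i t x := by
  choose G hG e using h
  exact ⟨fun y => ∑ i ∈ s, G i y, continuousOn_finsetSum _ fun i _ => hG i,
    fun y hy => Finset.sum_congr rfl fun i _ => e i hy⟩

theorem continuousOn (h : ExtendsContinuously Ω τ φ) :
    ContinuousOn (fun y : ℝ × Space => φ y.1 y.2) (openCylinder Ω τ) := by
  obtain ⟨G, hG, e⟩ := h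
  exact (hG.mono openCylinder_subset_closedCylinder).congr e

theorem continuousOn_slice (h : ExtendsContinuously Ω τ φ) {t : ℝ} (ht : t ∈ Ioo 0 τ) :
    ContinuousOn (φ t) Ω :=
  h.continuousOn.comp (f := fun x => (t, x)) (by fun_prop) fun _ hx => ⟨ht, hx⟩

/-- The extension is bounded on the compact closed cylinder, which gives a bound uniform in time for
the field inside. All constants in the dominated convergence and energy arguments come from here. -/
theorem exists_bound (h : ExtendsContinuously Ω τ φ) (hb : Bornology.IsBounded Ω) :
    ∃ C, 0 ≤ C ∧ ∀ t ∈ Ioo 0 τ, ∀ x ∈ Ω, |φ t x| ≤ C := by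
  obtain ⟨G, hG, e⟩ := h
  obtain ⟨C, hC⟩ := (isCompact_closedCylinder hb).exists_bound_of_continuousOn hG
  refine ⟨max C 0, le_max_right _ _, fun t ht x hx => ?_⟩
  have := e (show (t, x) ∈ openCylinder Ω τ from ⟨ht, hx⟩)
  rw [show φ t x = G (t, x) from this]
  exact (hC _ (openCylinder_subset_closedCylinder ⟨ht, hx⟩)).trans (le_max_left _ _)

theorem integrableOn (h : ExtendsContinuously Ω τ φ) (hΩ : IsOpen Ω)
    (hb : Bornology.IsBounded Ω) :
    IntegrableOn (fun y : ℝ × Space => φ y.1 y.2) (openCylinder Ω τ) := by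
  obtain ⟨G, hG, e⟩ := h
  exact ((hG.integrableOn_compact (isCompact_closedCylinder hb)).mono_set
    openCylinder_subset_closedCylinder).congr_fun e.symm (isOpen_openCylinder hΩ).measurableSet

theorem integrableOn_slice (h : ExtendsContinuously Ω τ φ) (hΩ : IsOpen Ω)
    (hb : Bornology.IsBounded Ω) {t : ℝ} (ht : t ∈ Ioo 0 τ) : IntegrableOn (φ t) Ω := by
  obtain ⟨C, -, hC⟩ := h.exists_bound hb
  exact integrableOn_of_continuousOn_bounded hΩ hb (h.continuousOn_slice ht) (hC t ht)

end ExtendsContinuously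

theorem dx_congr (hΩ : IsOpen Ω) {t : ℝ} (h : EqOn (φ t) (ψ t) Ω) (j : Fin 3) {x : Space}
    (hx : x ∈ Ω) : dx j φ t x = dx j ψ t x := by
  simp only [dx]
  rw [(h.eventuallyEq_of_mem (hΩ.mem_nhds hx)).fderiv_eq]

theorem dx_mul {j : Fin 3} {t : ℝ} {x : Space} (h : DifferentiableAt ℝ (φ t) x)
    (h' : DifferentiableAt ℝ (ψ t) x) :
    dx j (fun t x => φ t x * ψ t x) t x = dx j φ t x * ψ t x + φ t x * dx j ψ t x :=
  fderiv_mul_apply h h'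

theorem dx_add_smul {j : Fin 3} {t : ℝ} {x : Space} (h : DifferentiableAt ℝ (φ t) x)
    (h' : DifferentiableAt ℝ (ψ t) x) (s : ℝ) :
    dx j (φ + s • ψ) t x = dx j φ t x + s * dx j ψ t x := by
  have : (φ + s • ψ) t = fun y => φ t y + s * ψ t y := rfl
  simp only [dx]
  rw [this, fderiv_fun_add h (h'.const_mul s), fderiv_const_mul h']
  simp

theorem dt_add_smul {t : ℝ} {x : Space} (h : DifferentiableAt ℝ (fun r => φ r x) t)
    (h' : DifferentiableAt ℝ (fun r => ψ r x) t) (s : ℝ) :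
    dt (φ + s • ψ) t x = dt φ t x + s * dt ψ t x := by
  have : (fun r => (φ + s • ψ) r x) = fun r => φ r x + s * ψ r x := rfl
  simp only [dt]
  rw [this, deriv_fun_add h (h'.const_mul s), deriv_const_mul _ h']

theorem dt_congr {t : ℝ} (ht : t ∈ Ioo 0 τ) {x : Space} (h : ∀ r ∈ Ioo 0 τ, φ r x = ψ r x) :
    dt φ t x = dt ψ t x := by
  have : EqOn (fun r => φ r x) (fun r => ψ r x) (Ioo 0 τ) := h
  simp only [dt]
  rw [(this.eventuallyEq_of_mem (isOpen_Ioo.mem_nhds ht)).deriv_eq]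

/-- `φ` and its first order spatial derivatives extend continuously from the open to the closed
cylinder. -/
structure InteriorC1 (Ω : Set Space) (τ : ℝ) (φ : ScalarField) : Prop where
  extends_self : ExtendsContinuously Ω τ φ
  contDiffOn : ∀ t ∈ Ioo 0 τ, ContDiffOn ℝ 1 (φ t) Ω
  extends_dx : ∀ j, ExtendsContinuously Ω τ (dx j φ)

theorem contDiffOn_dx (hΩ : IsOpen Ω) {t : ℝ} (h : ContDiffOn ℝ 2 (φ t) Ω) (j : Fin 3) :
    ContDiffOn ℝ 1 (dx j φ t) Ω :=
  (h.fderiv_of_isOpen (m := 1) hΩ (by norm_num)).clm_apply contDiffOn_const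

namespace InteriorC1

theorem differentiableAt (h : InteriorC1 Ω τ φ) (hΩ : IsOpen Ω) {t : ℝ} (ht : t ∈ Ioo 0 τ)
    {x : Space} (hx : x ∈ Ω) : DifferentiableAt ℝ (φ t) x :=
  ((h.contDiffOn t ht).contDiffAt (hΩ.mem_nhds hx)).differentiableAt one_ne_zero

theorem const (c : ℝ) : InteriorC1 Ω τ fun _ _ => c :=
  ⟨.const c, fun _ _ => contDiffOn_const,
    fun j => (ExtendsContinuously.const 0).congr fun t _ x _ => by simp [dx]⟩

theorem mul (hΩ : IsOpen Ω) (h : InteriorC1 Ω τ φ) (h' : InteriorC1 Ω τ ψ) :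
    InteriorC1 Ω τ fun t x => φ t x * ψ t x where
  extends_self := h.extends_self.mul h'.extends_self
  contDiffOn t ht := (h.contDiffOn t ht).mul (h'.contDiffOn t ht)
  extends_dx j := (((h.extends_dx j).mul h'.extends_self).add
    (h.extends_self.mul (h'.extends_dx j))).congr fun _ ht _ hx =>
      dx_mul (h.differentiableAt hΩ ht hx) (h'.differentiableAt hΩ ht hx)

theorem add_smul (hΩ : IsOpen Ω) (h : InteriorC1 Ω τ φ) (h' : InteriorC1 Ω τ ψ) (s : ℝ) :
    InteriorC1 Ω τ (φ + s • ψ) where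
  extends_self := h.extends_self.add ((ExtendsContinuously.const s).mul h'.extends_self)
  contDiffOn t ht := (h.contDiffOn t ht).add (contDiffOn_const.mul (h'.contDiffOn t ht))
  extends_dx j := ((h.extends_dx j).add
    ((ExtendsContinuously.const s).mul (h'.extends_dx j))).congr fun _ ht _ hx =>
      dx_add_smul (h.differentiableAt hΩ ht hx) (h'.differentiableAt hΩ ht hx) s

end InteriorC1

theorem PressureRegular.interiorC1 (h : PressureRegular Ω τ φ) : InteriorC1 Ω τ φ :=
  ⟨.of_continuousOn h.continuousOn, h.contDiffOn, h.extends_dx⟩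

theorem PressureRegular.add_smul (hΩ : IsOpen Ω) (h : PressureRegular Ω τ φ)
    (h' : PressureRegular Ω τ ψ) (s : ℝ) : PressureRegular Ω τ (φ + s • ψ) where
  continuousOn := h.continuousOn.add (continuousOn_const.mul h'.continuousOn)
  contDiffOn := (h.interiorC1.add_smul hΩ h'.interiorC1 s).contDiffOn
  extends_dx := (h.interiorC1.add_smul hΩ h'.interiorC1 s).extends_dx

theorem PressureRegular.mul (hΩ : IsOpen Ω) (h : PressureRegular Ω τ φ)
    (h' : PressureRegular Ω τ ψ) : PressureRegular Ω τ (fun t x => φ t x * ψ t x) where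
  continuousOn := h.continuousOn.mul h'.continuousOn
  contDiffOn := (h.interiorC1.mul hΩ h'.interiorC1).contDiffOn
  extends_dx := (h.interiorC1.mul hΩ h'.interiorC1).extends_dx

namespace VelocityRegular

/-- `PressureRegular` also serves as the hypothesis on the factor vanishing on the boundary in
integration by parts: that factor must itself be continuous on the closed cylinder. -/
theorem pressureRegular (h : VelocityRegular Ω τ φ) : PressureRegular Ω τ φ :=
  ⟨h.continuousOn, fun t ht => (h.contDiffOn t ht).of_le one_le_two, h.extends_dx⟩

theorem interiorC1 (h : VelocityRegular Ω τ φ) : InteriorC1 Ω τ φ :=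
  h.pressureRegular.interiorC1

/-- A spatial derivative is continuous up to the boundary only through its extension. This suffices
for the other factor in integration by parts, as needed for the viscous terms. -/
theorem interiorC1_dx (hΩ : IsOpen Ω) (h : VelocityRegular Ω τ φ) (j : Fin 3) :
    InteriorC1 Ω τ (dx j φ) :=
  ⟨h.extends_dx j, fun t ht => contDiffOn_dx hΩ (h.contDiffOn t ht) j, fun k => h.extends_dxdx k j⟩

theorem dx_dx_add_smul (hΩ : IsOpen Ω) (h : VelocityRegular Ω τ φ) (h' : VelocityRegular Ω τ ψ)
    (s : ℝ) (j k : Fin 3) {t : ℝ} (ht : t ∈ Ioo 0 τ) {x : Space} (hx : x ∈ Ω) :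
    dx j (dx k (φ + s • ψ)) t x = dx j (dx k φ) t x + s * dx j (dx k ψ) t x := by
  rw [← dx_add_smul ((h.interiorC1_dx hΩ k).differentiableAt hΩ ht hx)
    ((h'.interiorC1_dx hΩ k).differentiableAt hΩ ht hx)]
  refine dx_congr hΩ (fun y hy => ?_) j hx
  exact dx_add_smul (h.interiorC1.differentiableAt hΩ ht hy)
    (h'.interiorC1.differentiableAt hΩ ht hy) s

theorem add_smul (hΩ : IsOpen Ω) (h : VelocityRegular Ω τ φ) (h' : VelocityRegular Ω τ ψ) (s : ℝ) :
    VelocityRegular Ω τ (φ + s • ψ) where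
  continuousOn := (h.pressureRegular.add_smul hΩ h'.pressureRegular s).continuousOn
  contDiffOn t ht := (h.contDiffOn t ht).add (contDiffOn_const.mul (h'.contDiffOn t ht))
  differentiableAt t ht x hx :=
    (h.differentiableAt t ht x hx).add ((h'.differentiableAt t ht x hx).const_mul s)
  extends_dx := (h.interiorC1.add_smul hΩ h'.interiorC1 s).extends_dx
  extends_dxdx j k := ((h.extends_dxdx j k).add ((ExtendsContinuously.const s).mul
    (h'.extends_dxdx j k))).congr fun _ ht _ hx => dx_dx_add_smul hΩ h h' s j k ht hx
  extends_dt := (h.extends_dt.add ((ExtendsContinuously.const s).mul h'.extends_dt)).congr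
    fun t ht x hx => dt_add_smul (h.differentiableAt t ht x hx) (h'.differentiableAt t ht x hx) s

theorem extends_laplacian (h : VelocityRegular Ω τ φ) : ExtendsContinuously Ω τ (laplacian φ) :=
  .sum fun j => h.extends_dxdx j j

theorem laplacian_add_smul (hΩ : IsOpen Ω) (h : VelocityRegular Ω τ φ)
    (h' : VelocityRegular Ω τ ψ) (s : ℝ) {t : ℝ} (ht : t ∈ Ioo 0 τ) {x : Space} (hx : x ∈ Ω) :
    laplacian (φ + s • ψ) t x = laplacian φ t x + s * laplacian ψ t x := by
  simp only [laplacian, Finset.mul_sum, ← Finset.sum_add_distrib]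
  exact Finset.sum_congr rfl fun j _ => dx_dx_add_smul hΩ h h' s j j ht hx

end VelocityRegular

theorem Admissible.add_smul (hΩ : IsOpen Ω) {f : VectorField} {g : Fin 3 → Space → ℝ}
    {z h : Fields} (hz : Admissible Ω τ f g z) (hh : AdmissibleVariation Ω τ h) (s : ℝ) :
    Admissible Ω τ f g (z + s • h) where
  regular_u i := (hz.regular_u i).add_smul hΩ (hh.regular_u i) s
  regular_w i := (hz.regular_w i).add_smul hΩ (hh.regular_w i) s
  regular_p := hz.regular_p.add_smul hΩ hh.regular_p s
  regular_r := hz.regular_r.add_smul hΩ hh.regular_r s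
  boundary_u i t ht x hx := by
    have h1 := hz.boundary_u i t ht x hx
    have h2 := hh.boundary_u i t ht x hx
    change z.u i t x + s * h.u i t x = _
    simp [h1, h2]
  boundary_w i t ht x hx := by
    have h1 := hz.boundary_w i t ht x hx
    have h2 := hh.boundary_w i t ht x hx
    change z.w i t x + s * h.w i t x = _
    simp [h1, h2]
  initial_u i x hx := by
    have h1 := hz.initial_u i x hx
    have h2 := hh.initial_u i x hx
    change z.u i 0 x + s * h.u i 0 x = _
    simp [h1, h2]
  initial_w i x hx := by
    have h1 := hz.initial_w i x hx
    have h2 := hh.initial_w i x hx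
    change z.w i 0 x + s * h.w i 0 x = _
    simp [h1, h2]
  final i x hx := by
    have h1 := hz.final i x hx
    have h2 := hh.final i x hx
    change z.u i τ x + s * h.u i τ x = z.w i τ x + s * h.w i τ x
    rw [h1, h2]
  boundary_pressure t ht x hx := by
    have h1 := hz.boundary_pressure t ht x hx
    have h2 := hh.boundary_pressure t ht x hx
    change z.p t x + s * h.p t x = z.r t x + s * h.r t x
    rw [h1, h2]

/-- Two functions continuous on the closed cylinder agree there if they agree inside. -/
theorem eq_on_closedCylinder (hτ : 0 < τ)
    (hφ : ContinuousOn (fun y : ℝ × Space => φ y.1 y.2) (closedCylinder Ω τ))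
    (hψ : ContinuousOn (fun y : ℝ × Space => ψ y.1 y.2) (closedCylinder Ω τ))
    (h : ∀ t ∈ Ioo 0 τ, ∀ x ∈ Ω, φ t x = ψ t x) :
    ∀ t ∈ Icc 0 τ, ∀ x ∈ closure Ω, φ t x = ψ t x := fun t ht x hx =>
  Set.EqOn.of_subset_closure (s := openCylinder Ω τ) (t := closedCylinder Ω τ)
    (f := fun y : ℝ × Space => φ y.1 y.2) (g := fun y : ℝ × Space => ψ y.1 y.2)
    (fun y hy => h y.1 hy.1 y.2 hy.2) hφ hψ openCylinder_subset_closedCylinder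
    (closedCylinder_subset_closure hτ) (show (t, x) ∈ closedCylinder Ω τ from ⟨ht, hx⟩)

/-! ### Integrals over the cylinder -/

theorem setIntegral_openCylinder (hΩ : IsOpen Ω) (hb : Bornology.IsBounded Ω)
    (h : ExtendsContinuously Ω τ φ) :
    ∫ y in openCylinder Ω τ, φ y.1 y.2 = ∫ t in Ioo 0 τ, ∫ x in Ω, φ t x :=
  setIntegral_prod _ (h.integrableOn hΩ hb)

theorem J_eq_setIntegral (hΩ : IsOpen Ω) (hb : Bornology.IsBounded Ω) (hτ : 0 < τ) {ν : ℝ}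
    {z : Fields} (h : ExtendsContinuously Ω τ (lagrangian ν z)) :
    J Ω ν τ z = ∫ y in openCylinder Ω τ, lagrangian ν z y.1 y.2 := by
  -- The derivatives are controlled only for `t` in the open interval; the end point `τ` is a null
  -- set.
  rw [setIntegral_openCylinder hΩ hb h, J, intervalIntegral.integral_of_le hτ.le,
    integral_Ioc_eq_integral_Ioo]

/-- Integration by parts in the spatial variables at a fixed time. -/
theorem setIntegral_slice_dx_mul_add (hΩ : IsOpen Ω) (hb : Bornology.IsBounded Ω)
    (hφ : PressureRegular Ω τ φ) (hψ : InteriorC1 Ω τ ψ) {t : ℝ} (ht : t ∈ Ioo 0 τ)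
    (h0 : ∀ x ∈ frontier Ω, φ t x = 0) (j : Fin 3) :
    ∫ x in Ω, (dx j φ t x * ψ t x + φ t x * dx j ψ t x) = 0 := by
  obtain ⟨C1, hC1, h1⟩ := hφ.interiorC1.extends_self.exists_bound hb
  obtain ⟨C2, hC2, h2⟩ := hψ.extends_self.exists_bound hb
  obtain ⟨C3, hC3, h3⟩ := (hφ.extends_dx j).exists_bound hb
  obtain ⟨C4, hC4, h4⟩ := (hψ.extends_dx j).exists_bound hb
  refine setIntegral_fderiv_mul_add (C := C1 + C2 + C3 + C4) hΩ hb ?_ h0 (hφ.contDiffOn t ht)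
    (hψ.contDiffOn t ht) (fun x hx => ?_) (fun x hx => ?_) (fun x hx => ?_) (fun x hx => ?_)
  · exact hφ.continuousOn.comp (f := fun x => (t, x)) (by fun_prop)
      fun x hx => ⟨Ioo_subset_Icc_self ht, hx⟩
  · linarith [h1 t ht x hx]
  · linarith [h2 t ht x hx]
  · exact (h3 t ht x hx).trans (by linarith)
  · exact (h4 t ht x hx).trans (by linarith)

/-- Integration by parts in the spatial variables over the cylinder. -/
theorem setIntegral_dx_mul_add (hΩ : IsOpen Ω) (hb : Bornology.IsBounded Ω)
    (hφ : PressureRegular Ω τ φ) (hψ : InteriorC1 Ω τ ψ)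
    (h0 : ∀ t ∈ Icc 0 τ, ∀ x ∈ frontier Ω, φ t x = 0) (j : Fin 3) :
    ∫ y in openCylinder Ω τ, (dx j φ y.1 y.2 * ψ y.1 y.2 + φ y.1 y.2 * dx j ψ y.1 y.2) = 0 := by
  rw [setIntegral_openCylinder (φ := fun t x => dx j φ t x * ψ t x + φ t x * dx j ψ t x) hΩ hb
    (((hφ.extends_dx j).mul hψ.extends_self).add
      (hφ.interiorC1.extends_self.mul (hψ.extends_dx j)))]
  refine setIntegral_eq_zero_of_forall_eq_zero fun t ht => ?_
  exact setIntegral_slice_dx_mul_add hΩ hb hφ hψ ht (h0 t (Ioo_subset_Icc_self ht)) j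

theorem setIntegral_dx (hΩ : IsOpen Ω) (hb : Bornology.IsBounded Ω)
    (hφ : PressureRegular Ω τ φ) (h0 : ∀ t ∈ Icc 0 τ, ∀ x ∈ frontier Ω, φ t x = 0) (j : Fin 3) :
    ∫ y in openCylinder Ω τ, dx j φ y.1 y.2 = 0 := by
  have := setIntegral_dx_mul_add hΩ hb hφ (InteriorC1.const 1) h0 j
  simpa [dx] using this

/-- The integral over the cylinder of the time derivative of a function vanishing initially and
finally. -/
theorem setIntegral_dt (hΩ : IsOpen Ω) (hb : Bornology.IsBounded Ω) (hτ : 0 < τ)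
    (hc : ContinuousOn (fun y : ℝ × Space => φ y.1 y.2) (closedCylinder Ω τ))
    (hd : ∀ t ∈ Ioo 0 τ, ∀ x ∈ Ω, DifferentiableAt ℝ (fun s => φ s x) t)
    (he : ExtendsContinuously Ω τ (dt φ)) (h0 : ∀ x ∈ Ω, φ 0 x = 0) (h1 : ∀ x ∈ Ω, φ τ x = 0) :
    ∫ y in openCylinder Ω τ, dt φ y.1 y.2 = 0 := by
  have hi := he.integrableOn hΩ hb
  have hi' : Integrable (fun y : ℝ × Space => dt φ y.1 y.2)
      ((volume.restrict (Ioo 0 τ)).prod (volume.restrict Ω)) := by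
    rw [Measure.prod_restrict]
    exact hi
  have e : (volume : Measure (ℝ × Space)).restrict (openCylinder Ω τ) =
      (volume.restrict (Ioo 0 τ)).prod (volume.restrict Ω) := by
    rw [Measure.prod_restrict]
    rfl
  -- Integrating in time first reduces the claim to the fundamental theorem of calculus at each
  -- fixed `x`.
  rw [e, integral_prod_symm _ hi']
  refine setIntegral_eq_zero_of_forall_eq_zero fun x hx => ?_
  obtain ⟨G, hG, hGe⟩ := he
  have hGs : ContinuousOn (fun t => G (t, x)) (Icc 0 τ) :=
    hG.comp (by fun_prop) fun t ht => ⟨ht, subset_closure hx⟩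
  have hii : IntervalIntegrable (fun t => dt φ t x) volume 0 τ := by
    rw [intervalIntegrable_iff_integrableOn_Ioo_of_le hτ.le]
    exact ((hGs.integrableOn_compact isCompact_Icc).mono_set Ioo_subset_Icc_self).congr_fun
      (fun t ht => (hGe (show (t, x) ∈ openCylinder Ω τ from ⟨ht, hx⟩)).symm) measurableSet_Ioo
  have := intervalIntegral.integral_eq_sub_of_hasDerivAt_of_le hτ.le
    (f := fun t => φ t x) (f' := fun t => dt φ t x)
    (hc.comp (f := fun t => (t, x)) (by fun_prop) fun t ht => ⟨ht, subset_closure hx⟩)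
    (fun t ht => (hd t ht x hx).hasDerivAt) hii
  rw [intervalIntegral.integral_of_le hτ.le, integral_Ioc_eq_integral_Ioo] at this
  simpa [h0 x hx, h1 x hx] using this

end Cylinder

/-! ### Expansion of the functional along a line -/

/-- The part of the Lagrangian in which `u` carries the leading terms: the Lagrangian is the
antisymmetrisation of this expression under `(u, p) ↔ (w, r)`. -/
def halfLagrangian (ν : ℝ) (u : VectorField) (p : ScalarField) (w : VectorField) : ScalarField :=
  fun t x => (∑ i, ∑ j, (ν / 2 * (dx j (u i) t x) ^ 2
      + 1 / 2 * (w i t x + u i t x) * u j t x * dx j (w i) t x))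
    + ∑ i, (u i t x * dx i p t x + u i t x / 2 * dt (w i) t x)

/-- The first order part of `halfLagrangian` in the direction `(a, q, b)`. -/
def halfLagrangian₁ (ν : ℝ) (u : VectorField) (p : ScalarField) (w : VectorField)
    (a : VectorField) (q : ScalarField) (b : VectorField) : ScalarField :=
  fun t x => (∑ i, ∑ j, (ν * (dx j (u i) t x * dx j (a i) t x)
      + 1 / 2 * ((b i t x + a i t x) * u j t x * dx j (w i) t x
        + (w i t x + u i t x) * a j t x * dx j (w i) t x
        + (w i t x + u i t x) * u j t x * dx j (b i) t x)))
    + ∑ i, (a i t x * dx i p t x + u i t x * dx i q t x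
      + (a i t x / 2 * dt (w i) t x + u i t x / 2 * dt (b i) t x))

/-- The second order part of `halfLagrangian` in the direction `(a, q, b)`. -/
def halfLagrangian₂ (ν : ℝ) (u w : VectorField)
    (a : VectorField) (q : ScalarField) (b : VectorField) : ScalarField :=
  fun t x => (∑ i, ∑ j, (ν / 2 * (dx j (a i) t x) ^ 2
      + 1 / 2 * ((b i t x + a i t x) * a j t x * dx j (w i) t x
        + (b i t x + a i t x) * u j t x * dx j (b i) t x
        + (w i t x + u i t x) * a j t x * dx j (b i) t x)))
    + ∑ i, (a i t x * dx i q t x + a i t x / 2 * dt (b i) t x)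

/-- The third order part of `halfLagrangian` in the direction `(a, q, b)`. -/
def halfLagrangian₃ (a b : VectorField) : ScalarField :=
  fun t x => ∑ i, ∑ j, 1 / 2 * (b i t x + a i t x) * a j t x * dx j (b i) t x

theorem lagrangian_eq (ν : ℝ) (z : Fields) (t : ℝ) (x : Space) :
    lagrangian ν z t x = halfLagrangian ν z.u z.p z.w t x - halfLagrangian ν z.w z.r z.u t x := by
  simp only [lagrangian, halfLagrangian]
  ring

section

variable {Ω : Set Space} {τ ν : ℝ} {u w a b : VectorField} {p q : ScalarField}

theorem halfLagrangian_add_smul (hΩ : IsOpen Ω)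
    (hu : ∀ i, VelocityRegular Ω τ (u i)) (hw : ∀ i, VelocityRegular Ω τ (w i))
    (ha : ∀ i, VelocityRegular Ω τ (a i)) (hb : ∀ i, VelocityRegular Ω τ (b i))
    (hp : PressureRegular Ω τ p) (hq : PressureRegular Ω τ q) (s : ℝ)
    {t : ℝ} (ht : t ∈ Ioo 0 τ) {x : Space} (hx : x ∈ Ω) :
    halfLagrangian ν (u + s • a) (p + s • q) (w + s • b) t x =
      halfLagrangian ν u p w t x + s * halfLagrangian₁ ν u p w a q b t x
        + s ^ 2 * halfLagrangian₂ ν u w a q b t x + s ^ 3 * halfLagrangian₃ a b t x := by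
  have eu : ∀ i j, dx j ((u + s • a) i) t x = dx j (u i) t x + s * dx j (a i) t x := fun i j =>
    dx_add_smul ((hu i).interiorC1.differentiableAt hΩ ht hx)
      ((ha i).interiorC1.differentiableAt hΩ ht hx) s
  have ew : ∀ i j, dx j ((w + s • b) i) t x = dx j (w i) t x + s * dx j (b i) t x := fun i j =>
    dx_add_smul ((hw i).interiorC1.differentiableAt hΩ ht hx)
      ((hb i).interiorC1.differentiableAt hΩ ht hx) s
  have ep : ∀ j, dx j (p + s • q) t x = dx j p t x + s * dx j q t x := fun j =>
    dx_add_smul (hp.interiorC1.differentiableAt hΩ ht hx)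
      (hq.interiorC1.differentiableAt hΩ ht hx) s
  have et : ∀ i, dt ((w + s • b) i) t x = dt (w i) t x + s * dt (b i) t x := fun i =>
    dt_add_smul ((hw i).differentiableAt t ht x hx) ((hb i).differentiableAt t ht x hx) s
  have vu : ∀ i, (u + s • a) i t x = u i t x + s * a i t x := fun i => rfl
  have vw : ∀ i, (w + s • b) i t x = w i t x + s * b i t x := fun i => rfl
  simp only [halfLagrangian, halfLagrangian₁, halfLagrangian₂, halfLagrangian₃, eu, ew, ep, et,
    vu, vw]
  -- Powers of `s` are matched summand by summand. The pressure and time-derivative terms are only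
  -- quadratic, so `h2` has no cubic part.
  have h1 : ∀ {F A B C D : Fin 3 → Fin 3 → ℝ},
      (∀ i j, F i j = A i j + s * B i j + s ^ 2 * C i j + s ^ 3 * D i j) →
      ∑ i, ∑ j, F i j = (∑ i, ∑ j, A i j) + s * (∑ i, ∑ j, B i j) + s ^ 2 * (∑ i, ∑ j, C i j)
        + s ^ 3 * ∑ i, ∑ j, D i j := fun h => by
    simp only [h, Finset.sum_add_distrib, Finset.mul_sum]
  have h2 : ∀ {F A B C : Fin 3 → ℝ}, (∀ i, F i = A i + s * B i + s ^ 2 * C i) →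
      ∑ i, F i = (∑ i, A i) + s * (∑ i, B i) + s ^ 2 * ∑ i, C i := fun h => by
    simp only [h, Finset.sum_add_distrib, Finset.mul_sum]
  have h3 : ∀ {F F' A A' B B' C C' D : ℝ}, F = A + s * B + s ^ 2 * C + s ^ 3 * D →
      F' = A' + s * B' + s ^ 2 * C' →
      F + F' = (A + A') + s * (B + B') + s ^ 2 * (C + C') + s ^ 3 * D := fun h h' => by
    rw [h, h']
    ring
  exact h3 (h1 fun i j => by ring) (h2 fun i => by ring)

theorem extends_halfLagrangian (hu : ∀ i, VelocityRegular Ω τ (u i))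
    (hw : ∀ i, VelocityRegular Ω τ (w i)) (hp : PressureRegular Ω τ p) :
    ExtendsContinuously Ω τ (halfLagrangian ν u p w) := by
  have u0 := fun i => (hu i).interiorC1.extends_self
  have w0 := fun i => (hw i).interiorC1.extends_self
  have u1 := fun i => (hu i).extends_dx
  have w1 := fun i => (hw i).extends_dx
  have w2 := fun i => (hw i).extends_dt
  have p1 := hp.extends_dx
  unfold halfLagrangian
  repeat' first
    | apply_assumption
    | refine .sum fun _ => ?_
    | exact .const _
    | refine .add ?_ ?_
    | refine .mul ?_ ?_

theorem extends_halfLagrangian₁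
    (hu : ∀ i, VelocityRegular Ω τ (u i)) (hw : ∀ i, VelocityRegular Ω τ (w i))
    (ha : ∀ i, VelocityRegular Ω τ (a i)) (hb : ∀ i, VelocityRegular Ω τ (b i))
    (hp : PressureRegular Ω τ p) (hq : PressureRegular Ω τ q) :
    ExtendsContinuously Ω τ (halfLagrangian₁ ν u p w a q b) := by
  have u0 := fun i => (hu i).interiorC1.extends_self
  have w0 := fun i => (hw i).interiorC1.extends_self
  have a0 := fun i => (ha i).interiorC1.extends_self
  have b0 := fun i => (hb i).interiorC1.extends_self
  have u1 := fun i => (hu i).extends_dx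
  have w1 := fun i => (hw i).extends_dx
  have a1 := fun i => (ha i).extends_dx
  have b1 := fun i => (hb i).extends_dx
  have w2 := fun i => (hw i).extends_dt
  have b2 := fun i => (hb i).extends_dt
  have p1 := hp.extends_dx
  have q1 := hq.extends_dx
  unfold halfLagrangian₁
  repeat' first
    | apply_assumption
    | refine .sum fun _ => ?_
    | exact .const _
    | refine .add ?_ ?_
    | refine .mul ?_ ?_

theorem extends_halfLagrangian₂
    (hu : ∀ i, VelocityRegular Ω τ (u i)) (hw : ∀ i, VelocityRegular Ω τ (w i))
    (ha : ∀ i, VelocityRegular Ω τ (a i)) (hb : ∀ i, VelocityRegular Ω τ (b i))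
    (hq : PressureRegular Ω τ q) :
    ExtendsContinuously Ω τ (halfLagrangian₂ ν u w a q b) := by
  have u0 := fun i => (hu i).interiorC1.extends_self
  have w0 := fun i => (hw i).interiorC1.extends_self
  have a0 := fun i => (ha i).interiorC1.extends_self
  have b0 := fun i => (hb i).interiorC1.extends_self
  have w1 := fun i => (hw i).extends_dx
  have a1 := fun i => (ha i).extends_dx
  have b1 := fun i => (hb i).extends_dx
  have b2 := fun i => (hb i).extends_dt
  have q1 := hq.extends_dx
  unfold halfLagrangian₂
  repeat' first
    | apply_assumption
    | refine .sum fun _ => ?_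
    | exact .const _
    | refine .add ?_ ?_
    | refine .mul ?_ ?_

theorem extends_halfLagrangian₃
    (ha : ∀ i, VelocityRegular Ω τ (a i)) (hb : ∀ i, VelocityRegular Ω τ (b i)) :
    ExtendsContinuously Ω τ (halfLagrangian₃ a b) := by
  have a0 := fun i => (ha i).interiorC1.extends_self
  have b0 := fun i => (hb i).interiorC1.extends_self
  have b1 := fun i => (hb i).extends_dx
  unfold halfLagrangian₃
  repeat' first
    | apply_assumption
    | refine .sum fun _ => ?_
    | exact .const _
    | refine .add ?_ ?_
    | refine .mul ?_ ?_

end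

section

variable {Ω : Set Space} {τ : ℝ} {f : VectorField} {g : Fin 3 → Space → ℝ} {z h : Fields}

theorem Admissible.extends_lagrangian (hz : Admissible Ω τ f g z) (ν : ℝ) :
    ExtendsContinuously Ω τ (lagrangian ν z) :=
  ((extends_halfLagrangian hz.regular_u hz.regular_w hz.regular_p).sub
    (extends_halfLagrangian hz.regular_w hz.regular_u hz.regular_r)).congr
      fun t _ x _ => lagrangian_eq ν z t x

/-- The first variation of `J` at `z` in the direction `h`. -/
def firstVariation (Ω : Set Space) (ν τ : ℝ) (z h : Fields) : ℝ :=
  ∫ y in openCylinder Ω τ, (halfLagrangian₁ ν z.u z.p z.w h.u h.p h.w y.1 y.2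
    - halfLagrangian₁ ν z.w z.r z.u h.w h.r h.u y.1 y.2)

/-- The quadratic coefficient of `J` at `z` in the direction `h`. -/
def secondVariation (Ω : Set Space) (ν τ : ℝ) (z h : Fields) : ℝ :=
  ∫ y in openCylinder Ω τ, (halfLagrangian₂ ν z.u z.w h.u h.p h.w y.1 y.2
    - halfLagrangian₂ ν z.w z.u h.w h.r h.u y.1 y.2)

/-- The cubic coefficient of `J` in the direction `h`. -/
def thirdVariation (Ω : Set Space) (τ : ℝ) (h : Fields) : ℝ :=
  ∫ y in openCylinder Ω τ, (halfLagrangian₃ h.u h.w y.1 y.2 - halfLagrangian₃ h.w h.u y.1 y.2)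

theorem integral_cubic {α : Type*} [MeasurableSpace α] {μ : Measure α} {F₀ F₁ F₂ F₃ : α → ℝ}
    (i₀ : Integrable F₀ μ) (i₁ : Integrable F₁ μ) (i₂ : Integrable F₂ μ) (i₃ : Integrable F₃ μ)
    (s : ℝ) : ∫ x, (F₀ x + s * F₁ x + s ^ 2 * F₂ x + s ^ 3 * F₃ x) ∂μ =
      ∫ x, F₀ x ∂μ + s * ∫ x, F₁ x ∂μ + s ^ 2 * ∫ x, F₂ x ∂μ + s ^ 3 * ∫ x, F₃ x ∂μ := by
  have j₁ : Integrable (fun x => F₀ x + s * F₁ x) μ := i₀.add (i₁.const_mul s)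
  have j₂ : Integrable (fun x => F₀ x + s * F₁ x + s ^ 2 * F₂ x) μ := j₁.add (i₂.const_mul _)
  rw [integral_add j₂ (i₃.const_mul _), integral_add j₁ (i₂.const_mul _),
    integral_add i₀ (i₁.const_mul s), integral_const_mul, integral_const_mul, integral_const_mul]

/-- Since the expansion is exact and every coefficient is integrable, differentiability in `s` needs
no differentiation under the integral. The same formula later describes `J` globally along a line.
-/
theorem J_add_smul (hΩ : IsOpen Ω) (hbd : Bornology.IsBounded Ω) (hτ : 0 < τ) (ν : ℝ)
    (hz : Admissible Ω τ f g z) (hh : AdmissibleVariation Ω τ h) (s : ℝ) :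
    J Ω ν τ (z + s • h) = J Ω ν τ z + s * firstVariation Ω ν τ z h
      + s ^ 2 * secondVariation Ω ν τ z h + s ^ 3 * thirdVariation Ω τ h := by
  have hzs := hz.add_smul hΩ hh s
  have i0 := (hz.extends_lagrangian ν).integrableOn hΩ hbd
  have i1 := ((extends_halfLagrangian₁ (ν := ν) hz.regular_u hz.regular_w hh.regular_u hh.regular_w
    hz.regular_p hh.regular_p).sub (extends_halfLagrangian₁ (ν := ν) hz.regular_w hz.regular_u
      hh.regular_w hh.regular_u hz.regular_r hh.regular_r)).integrableOn hΩ hbd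
  have i2 := ((extends_halfLagrangian₂ (ν := ν) hz.regular_u hz.regular_w hh.regular_u hh.regular_w
    hh.regular_p).sub (extends_halfLagrangian₂ (ν := ν) hz.regular_w hz.regular_u
      hh.regular_w hh.regular_u hh.regular_r)).integrableOn hΩ hbd
  have i3 := ((extends_halfLagrangian₃ hh.regular_u hh.regular_w).sub
    (extends_halfLagrangian₃ hh.regular_w hh.regular_u)).integrableOn hΩ hbd
  rw [J_eq_setIntegral hΩ hbd hτ (hzs.extends_lagrangian ν),
    J_eq_setIntegral hΩ hbd hτ (hz.extends_lagrangian ν), firstVariation, secondVariation,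
    thirdVariation, ← integral_cubic i0 i1 i2 i3 s]
  refine setIntegral_congr_fun (isOpen_openCylinder hΩ).measurableSet fun y hy => ?_
  have e1 := halfLagrangian_add_smul (ν := ν) hΩ hz.regular_u hz.regular_w hh.regular_u
    hh.regular_w hz.regular_p hh.regular_p s hy.1 hy.2
  have e2 := halfLagrangian_add_smul (ν := ν) hΩ hz.regular_w hz.regular_u hh.regular_w
    hh.regular_u hz.regular_r hh.regular_r s hy.1 hy.2
  simp only [lagrangian_eq]
  refine (congrArg₂ (· - ·) e1 e2).trans ?_
  ring

theorem hasDerivAt_J (hΩ : IsOpen Ω) (hbd : Bornology.IsBounded Ω) (hτ : 0 < τ) (ν : ℝ)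
    (hz : Admissible Ω τ f g z) (hh : AdmissibleVariation Ω τ h) :
    HasDerivAt (fun s : ℝ => J Ω ν τ (z + s • h)) (firstVariation Ω ν τ z h) 0 := by
  simp only [J_add_smul hΩ hbd hτ ν hz hh]
  have h1 := (hasDerivAt_id (0 : ℝ)).mul_const (firstVariation Ω ν τ z h)
  have h2 := ((hasDerivAt_id (0 : ℝ)).pow 2).mul_const (secondVariation Ω ν τ z h)
  have h3 := ((hasDerivAt_id (0 : ℝ)).pow 3).mul_const (thirdVariation Ω τ h)
  have := ((h1.const_add (J Ω ν τ z)).add h2).add h3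
  refine this.congr_deriv ?_
  simp

theorem isStationaryPoint_iff_firstVariation (hΩ : IsOpen Ω) (hbd : Bornology.IsBounded Ω)
    (hτ : 0 < τ) (ν : ℝ) (hz : Admissible Ω τ f g z) :
    IsStationaryPoint Ω ν τ f g z ↔
      ∀ h, AdmissibleVariation Ω τ h → firstVariation Ω ν τ z h = 0 := by
  refine ⟨fun hs h hh => (hasDerivAt_J hΩ hbd hτ ν hz hh).unique (hs.2 h hh),
    fun hs => ⟨hz, fun h hh => ?_⟩⟩
  have := hasDerivAt_J hΩ hbd hτ ν hz hh
  rwa [hs h hh] at this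

end

/-! ### The first variation, integrated by parts -/

/-- The field extends continuously to the closed cylinder and has vanishing integral. -/
structure ExtendsWithZeroIntegral (Ω : Set Space) (τ : ℝ) (φ : ScalarField) : Prop where
  extends_self : ExtendsContinuously Ω τ φ
  integral_eq_zero : ∫ y in openCylinder Ω τ, φ y.1 y.2 = 0

namespace ExtendsWithZeroIntegral

variable {Ω : Set Space} {τ : ℝ} {φ ψ : ScalarField}

theorem add (hΩ : IsOpen Ω) (hb : Bornology.IsBounded Ω) (h : ExtendsWithZeroIntegral Ω τ φ)
    (h' : ExtendsWithZeroIntegral Ω τ ψ) :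
    ExtendsWithZeroIntegral Ω τ fun t x => φ t x + ψ t x := by
  refine ⟨h.1.add h'.1, ?_⟩
  rw [integral_add (h.1.integrableOn hΩ hb) (h'.1.integrableOn hΩ hb), h.2, h'.2, add_zero]

theorem const_mul (h : ExtendsWithZeroIntegral Ω τ φ) (c : ℝ) :
    ExtendsWithZeroIntegral Ω τ fun t x => c * φ t x := by
  refine ⟨(ExtendsContinuously.const c).mul h.1, ?_⟩
  rw [integral_const_mul, h.2, mul_zero]

theorem sum (hΩ : IsOpen Ω) (hb : Bornology.IsBounded Ω) {ι : Type*} {s : Finset ι}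
    {Φ : ι → ScalarField} (h : ∀ i, ExtendsWithZeroIntegral Ω τ (Φ i)) :
    ExtendsWithZeroIntegral Ω τ fun t x => ∑ i ∈ s, Φ i t x := by
  refine ⟨.sum fun i => (h i).1, ?_⟩
  rw [integral_finsetSum _ fun i _ => (h i).1.integrableOn hΩ hb]
  exact Finset.sum_eq_zero fun i _ => (h i).2

end ExtendsWithZeroIntegral

/-- The left hand side of the Euler-Lagrange equation obtained by varying `u`. -/
def momentumResidual (ν : ℝ) (u : VectorField) (p : ScalarField) (w : VectorField) (i : Fin 3) :
    ScalarField := fun t x =>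
  dx i p t x - ν * laplacian (u i) t x + dt (w i) t x
    + (∑ j, (u j t x + w j t x) / 2 * (dx j (w i) t x + dx i (w j) t x))
    + 1 / 2 * (u i t x + w i t x) * ∑ j, dx j (w j) t x

/-- The density of the first variation after integration by parts. -/
def variationDensity (ν : ℝ) (z h : Fields) : ScalarField := fun t x =>
  (∑ i, (h.u i t x * momentumResidual ν z.u z.p z.w i t x
    - h.w i t x * momentumResidual ν z.w z.r z.u i t x))
  - (∑ i, dx i (z.u i) t x) * h.p t x + (∑ i, dx i (z.w i) t x) * h.r t x

section

variable {Ω : Set Space} {τ : ℝ} {f : VectorField} {g : Fin 3 → Space → ℝ} {z h : Fields}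

theorem extends_momentumResidual {ν : ℝ} {u w : VectorField} {p : ScalarField}
    (hu : ∀ i, VelocityRegular Ω τ (u i)) (hw : ∀ i, VelocityRegular Ω τ (w i))
    (hp : PressureRegular Ω τ p) (i : Fin 3) :
    ExtendsContinuously Ω τ (momentumResidual ν u p w i) := by
  have u0 := fun i => (hu i).interiorC1.extends_self
  have w0 := fun i => (hw i).interiorC1.extends_self
  have w1 := fun i => (hw i).extends_dx
  have w2 := fun i => (hw i).extends_dt
  have u2 := fun i => (hu i).extends_laplacian
  have p1 := hp.extends_dx
  unfold momentumResidual
  repeat' first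
    | apply_assumption
    | refine .sum fun _ => ?_
    | exact .const _
    | refine .sub ?_ ?_
    | refine .add ?_ ?_
    | refine .mul ?_ ?_

theorem Admissible.extends_variationDensity (hz : Admissible Ω τ f g z)
    (hh : AdmissibleVariation Ω τ h) (ν : ℝ) :
    ExtendsContinuously Ω τ (variationDensity ν z h) := by
  have h1 := extends_momentumResidual (ν := ν) hz.regular_u hz.regular_w hz.regular_p
  have h2 := extends_momentumResidual (ν := ν) hz.regular_w hz.regular_u hz.regular_r
  have h3 := fun i => (hh.regular_u i).interiorC1.extends_self
  have h4 := fun i => (hh.regular_w i).interiorC1.extends_self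
  exact ((ExtendsContinuously.sum fun i => ((h3 i).mul (h1 i)).sub ((h4 i).mul (h2 i))).sub
    ((ExtendsContinuously.sum fun i => (hz.regular_u i).extends_dx i).mul
      hh.regular_p.interiorC1.extends_self)).add
    ((ExtendsContinuously.sum fun i => (hz.regular_w i).extends_dx i).mul
      hh.regular_r.interiorC1.extends_self)

theorem firstVariation_eq (hΩ : IsOpen Ω) (hbd : Bornology.IsBounded Ω) (hτ : 0 < τ) (ν : ℝ)
    (hz : Admissible Ω τ f g z) (hh : AdmissibleVariation Ω τ h) :
    firstVariation Ω ν τ z h = ∫ y in openCylinder Ω τ, variationDensity ν z h y.1 y.2 := by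
  have parts : ∀ {φ ψ : ScalarField}, PressureRegular Ω τ φ → InteriorC1 Ω τ ψ →
      (∀ t ∈ Icc 0 τ, ∀ x ∈ frontier Ω, φ t x = 0) → ∀ j, ExtendsWithZeroIntegral Ω τ
        fun t x => dx j φ t x * ψ t x + φ t x * dx j ψ t x := fun hφ hψ h0 j =>
    ⟨((hφ.extends_dx j).mul hψ.extends_self).add
      (hφ.interiorC1.extends_self.mul (hψ.extends_dx j)),
      setIntegral_dx_mul_add hΩ hbd hφ hψ h0 j⟩
  have zu := fun i => (hz.regular_u i).interiorC1
  have zw := fun i => (hz.regular_w i).interiorC1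
  have hu0 : ∀ i, ∀ t ∈ Icc 0 τ, ∀ x ∈ frontier Ω, h.u i t x = 0 := hh.boundary_u
  have hw0 : ∀ i, ∀ t ∈ Icc 0 τ, ∀ x ∈ frontier Ω, h.w i t x = 0 := hh.boundary_w
  -- the viscous terms
  have k1 := fun i j => parts (hh.regular_u i).pressureRegular
    ((hz.regular_u i).interiorC1_dx hΩ j) (hu0 i) j
  have k2 := fun i j => parts (hh.regular_w i).pressureRegular
    ((hz.regular_w i).interiorC1_dx hΩ j) (hw0 i) j
  -- the convective terms
  have k3 := fun i j => parts (hh.regular_u i).pressureRegular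
    (((zu i).add_smul hΩ (zw i) 1).mul hΩ (zw j)) (hu0 i) j
  have k4 := fun i j => parts (hh.regular_w i).pressureRegular
    (((zw i).add_smul hΩ (zu i) 1).mul hΩ (zu j)) (hw0 i) j
  -- the pressure terms
  have r5 := fun i => ((hz.regular_u i).pressureRegular.mul hΩ hh.regular_p).add_smul hΩ
    ((hz.regular_w i).pressureRegular.mul hΩ hh.regular_r) (-1)
  -- Neither product vanishes on the boundary by itself; their difference does, because there `u = w
  -- = f` and `δp = δr`. This is why no flux condition on `f` is needed.
  have k5 : ∀ i, ExtendsWithZeroIntegral Ω τ (dx i ((fun t x => z.u i t x * h.p t x)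
      + (-1 : ℝ) • fun t x => z.w i t x * h.r t x)) := fun i =>
    ⟨(r5 i).extends_dx i, setIntegral_dx hΩ hbd (r5 i) (fun t ht x hx => by
      have e1 := hz.boundary_u i t ht x hx
      have e2 := hz.boundary_w i t ht x hx
      have e3 := hh.boundary_pressure t ht x hx
      change z.u i t x * h.p t x + (-1) * (z.w i t x * h.r t x) = 0
      rw [e1, e2, e3]
      ring) i⟩
  -- the inertial terms
  have d6 : ∀ i, ∀ t ∈ Ioo 0 τ, ∀ x ∈ Ω, HasDerivAt
      (fun s => z.u i s x * h.w i s x - z.w i s x * h.u i s x)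
      ((dt (z.u i) t x * h.w i t x + z.u i t x * dt (h.w i) t x)
        - (dt (z.w i) t x * h.u i t x + z.w i t x * dt (h.u i) t x)) t := fun i t ht x hx =>
    (((hz.regular_u i).differentiableAt t ht x hx).hasDerivAt.mul
      ((hh.regular_w i).differentiableAt t ht x hx).hasDerivAt).sub
    (((hz.regular_w i).differentiableAt t ht x hx).hasDerivAt.mul
      ((hh.regular_u i).differentiableAt t ht x hx).hasDerivAt)
  have x6 : ∀ i, ExtendsContinuously Ω τ
      (dt fun t x => z.u i t x * h.w i t x - z.w i t x * h.u i t x) := fun i =>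
    ((((hz.regular_u i).extends_dt.mul (hh.regular_w i).interiorC1.extends_self).add
      ((zu i).extends_self.mul (hh.regular_w i).extends_dt)).sub
    (((hz.regular_w i).extends_dt.mul (hh.regular_u i).interiorC1.extends_self).add
      ((zw i).extends_self.mul (hh.regular_u i).extends_dt))).congr
        fun t ht x hx => (d6 i t ht x hx).deriv
  -- At `t = 0` the variations vanish; at `t = τ` the two products cancel because `u = w` and `δu =
  -- δw`.
  have k6 : ∀ i, ExtendsWithZeroIntegral Ω τ
      (dt fun t x => z.u i t x * h.w i t x - z.w i t x * h.u i t x) := fun i =>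
    ⟨x6 i, setIntegral_dt hΩ hbd hτ
      (((hz.regular_u i).continuousOn.mul (hh.regular_w i).continuousOn).sub
        ((hz.regular_w i).continuousOn.mul (hh.regular_u i).continuousOn))
      (fun t ht x hx => (d6 i t ht x hx).differentiableAt) (x6 i)
      (fun x hx => by
        have e1 := hh.initial_u i x hx
        have e2 := hh.initial_w i x hx
        simp only [Pi.zero_apply] at e1 e2
        rw [e1, e2]
        ring)
      (fun x hx => by
        rw [hz.final i x hx, hh.final i x hx]
        ring)⟩
  -- The weights are those with which the integrated-by-parts identities enter the Lagrangian, so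
  -- that this null integrand is exactly the first variation integrand minus `variationDensity`.
  have tot := ((ExtendsWithZeroIntegral.sum (s := Finset.univ) hΩ hbd fun i =>
      ExtendsWithZeroIntegral.sum (s := Finset.univ) hΩ hbd fun j =>
      (((k1 i j).const_mul ν).add hΩ hbd ((k2 i j).const_mul (-ν))).add hΩ hbd
      (((k3 i j).const_mul (-1 / 2)).add hΩ hbd ((k4 i j).const_mul (1 / 2)))).add hΩ hbd
    (ExtendsWithZeroIntegral.sum (s := Finset.univ) hΩ hbd fun i =>
      (k5 i).add hΩ hbd ((k6 i).const_mul (1 / 2)))).integral_eq_zero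
  have iv := (hz.extends_variationDensity hh ν).integrableOn hΩ hbd
  have i1 := ((extends_halfLagrangian₁ (ν := ν) hz.regular_u hz.regular_w hh.regular_u hh.regular_w
    hz.regular_p hh.regular_p).sub (extends_halfLagrangian₁ (ν := ν) hz.regular_w hz.regular_u
      hh.regular_w hh.regular_u hz.regular_r hh.regular_r)).integrableOn hΩ hbd
  rw [firstVariation, ← sub_eq_zero, ← integral_sub i1 iv, ← tot]
  refine setIntegral_congr_fun (isOpen_openCylinder hΩ).measurableSet fun y hy => ?_
  obtain ⟨t, x⟩ := y
  obtain ⟨ht, hx⟩ := hy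
  have du := fun i => (zu i).differentiableAt hΩ ht hx
  have dw := fun i => (zw i).differentiableAt hΩ ht hx
  have dp := hh.regular_p.interiorC1.differentiableAt hΩ ht hx
  have dr := hh.regular_r.interiorC1.differentiableAt hΩ ht hx
  have e3 : ∀ i j, dx j (fun t x => (z.u i + (1 : ℝ) • z.w i) t x * z.w j t x) t x =
      (dx j (z.u i) t x + dx j (z.w i) t x) * z.w j t x
        + (z.u i t x + z.w i t x) * dx j (z.w j) t x := fun i j => by
    rw [dx_mul (((zu i).add_smul hΩ (zw i) 1).differentiableAt hΩ ht hx) (dw j),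
      dx_add_smul (du i) (dw i)]
    simp [Pi.add_apply]
  have e4 : ∀ i j, dx j (fun t x => (z.w i + (1 : ℝ) • z.u i) t x * z.u j t x) t x =
      (dx j (z.w i) t x + dx j (z.u i) t x) * z.u j t x
        + (z.w i t x + z.u i t x) * dx j (z.u j) t x := fun i j => by
    rw [dx_mul (((zw i).add_smul hΩ (zu i) 1).differentiableAt hΩ ht hx) (du j),
      dx_add_smul (dw i) (du i)]
    simp [Pi.add_apply]
  have e5 : ∀ i, dx i ((fun t x => z.u i t x * h.p t x)
      + (-1 : ℝ) • fun t x => z.w i t x * h.r t x) t x =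
      (dx i (z.u i) t x * h.p t x + z.u i t x * dx i h.p t x)
        - (dx i (z.w i) t x * h.r t x + z.w i t x * dx i h.r t x) := fun i => by
    rw [dx_add_smul ((du i).mul dp) ((dw i).mul dr), dx_mul (du i) dp, dx_mul (dw i) dr]
    ring
  have e6 : ∀ i, dt (fun t x => z.u i t x * h.w i t x - z.w i t x * h.u i t x) t x =
      (dt (z.u i) t x * h.w i t x + z.u i t x * dt (h.w i) t x)
        - (dt (z.w i) t x * h.u i t x + z.w i t x * dt (h.u i) t x) := fun i =>
    (d6 i t ht x hx).deriv
  have v1 : ∀ i, (z.u i + (1 : ℝ) • z.w i) t x = z.u i t x + z.w i t x := fun i => by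
    simp [Pi.add_apply]
  have v2 : ∀ i, (z.w i + (1 : ℝ) • z.u i) t x = z.w i t x + z.u i t x := fun i => by
    simp [Pi.add_apply]
  simp only [e3, e4, e5, e6, v1, v2, halfLagrangian₁, variationDensity, momentumResidual,
    laplacian, Fin.sum_univ_three]
  ring

end

/-! ### Test functions and the Euler-Lagrange system -/

/-- A smooth function on space-time, as a scalar field. -/
def ofSpaceTime (χ : ℝ × Space → ℝ) : ScalarField := fun t x => χ (t, x)

section

variable {Ω : Set Space} {τ : ℝ} {χ : ℝ × Space → ℝ}

theorem dx_ofSpaceTime (hχ : Differentiable ℝ χ) (j : Fin 3) :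
    dx j (ofSpaceTime χ) =
      ofSpaceTime fun y => fderiv ℝ χ y ((0 : ℝ), EuclideanSpace.single j (1 : ℝ)) := by
  funext t x
  have h : HasFDerivAt (fun x : Space => (t, x)) (ContinuousLinearMap.inr ℝ ℝ Space) x :=
    hasFDerivAt_prodMk_right t x
  have := ((hχ (t, x)).hasFDerivAt.comp x h).fderiv
  simp only [dx, ofSpaceTime]
  change fderiv ℝ (χ ∘ fun x => (t, x)) x _ = _
  rw [this]
  simp

theorem hasDerivAt_ofSpaceTime (hχ : Differentiable ℝ χ) (t : ℝ) (x : Space) :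
    HasDerivAt (fun s => ofSpaceTime χ s x) (fderiv ℝ χ (t, x) ((1 : ℝ), (0 : Space))) t :=
  (hχ (t, x)).hasFDerivAt.comp_hasDerivAt (f := fun s => (s, x)) t
    ((hasDerivAt_id t).prodMk (hasDerivAt_const t x))

theorem contDiff_fderiv_apply (hχ : ContDiff ℝ (⊤ : ℕ∞) χ) (v : ℝ × Space) :
    ContDiff ℝ (⊤ : ℕ∞) fun y => fderiv ℝ χ y v :=
  (hχ.fderiv_right (m := (⊤ : ℕ∞)) (by norm_cast)).clm_apply contDiff_const

theorem extends_ofSpaceTime (hχ : Continuous χ) : ExtendsContinuously Ω τ (ofSpaceTime χ) :=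
  .of_continuousOn hχ.continuousOn

theorem velocityRegular_ofSpaceTime (hχ : ContDiff ℝ (⊤ : ℕ∞) χ) :
    VelocityRegular Ω τ (ofSpaceTime χ) where
  continuousOn := hχ.continuous.continuousOn
  contDiffOn t _ := ((hχ.of_le (by norm_cast)).comp
    (contDiff_const.prodMk contDiff_id)).contDiffOn
  differentiableAt t _ x _ :=
    (hasDerivAt_ofSpaceTime (hχ.differentiable (by simp)) t x).differentiableAt
  extends_dx j := by
    rw [dx_ofSpaceTime (hχ.differentiable (by simp))]
    exact extends_ofSpaceTime (contDiff_fderiv_apply hχ _).continuous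
  extends_dxdx j k := by
    rw [dx_ofSpaceTime (hχ.differentiable (by simp)),
      dx_ofSpaceTime ((contDiff_fderiv_apply hχ _).differentiable (by simp))]
    exact extends_ofSpaceTime (contDiff_fderiv_apply (contDiff_fderiv_apply hχ _) _).continuous
  extends_dt := (extends_ofSpaceTime (contDiff_fderiv_apply hχ (1, 0)).continuous).congr
    fun t _ x _ => (hasDerivAt_ofSpaceTime (hχ.differentiable (by simp)) t x).deriv

/-- A smooth function with support in the open cylinder. -/
structure IsTestFunction (Ω : Set Space) (τ : ℝ) (χ : ℝ × Space → ℝ) : Prop where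
  contDiff : ContDiff ℝ (⊤ : ℕ∞) χ
  tsupport_subset : tsupport χ ⊆ openCylinder Ω τ

theorem IsTestFunction.zero : IsTestFunction Ω τ fun _ => 0 :=
  ⟨contDiff_const, by simp [tsupport, Function.support]⟩

theorem IsTestFunction.const_mul (h : IsTestFunction Ω τ χ) (c : ℝ) :
    IsTestFunction Ω τ fun y => c * χ y :=
  ⟨contDiff_const.mul h.contDiff,
    (tsupport_mul_subset_right (f := fun _ => c) (g := χ)).trans h.tsupport_subset⟩

theorem IsTestFunction.fderiv_apply (h : IsTestFunction Ω τ χ) (v : ℝ × Space) :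
    IsTestFunction Ω τ fun y => fderiv ℝ χ y v :=
  ⟨contDiff_fderiv_apply h.contDiff v, (tsupport_fderiv_apply_subset ℝ v).trans h.tsupport_subset⟩

theorem IsTestFunction.eq_zero (h : IsTestFunction Ω τ χ) {y : ℝ × Space}
    (hy : y ∉ openCylinder Ω τ) : χ y = 0 :=
  image_eq_zero_of_notMem_tsupport fun h' => hy (h.tsupport_subset h')

/-- The variation whose components are given functions on space-time. -/
def variationOf (a : Fin 3 → ℝ × Space → ℝ) (q : ℝ × Space → ℝ) (b : Fin 3 → ℝ × Space → ℝ)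
    (r : ℝ × Space → ℝ) : Fields :=
  (fun i => ofSpaceTime (a i), ofSpaceTime q, fun i => ofSpaceTime (b i), ofSpaceTime r)

theorem admissibleVariation_variationOf (hΩ : IsOpen Ω) {a b : Fin 3 → ℝ × Space → ℝ}
    {q r : ℝ × Space → ℝ} (ha : ∀ i, IsTestFunction Ω τ (a i)) (hq : IsTestFunction Ω τ q)
    (hb : ∀ i, IsTestFunction Ω τ (b i)) (hr : IsTestFunction Ω τ r) :
    AdmissibleVariation Ω τ (variationOf a q b r) := by
  -- Every lateral, initial and final point lies outside the open cylinder, so a test function meets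
  -- all the homogeneous conditions at once.
  have hfr : ∀ t, ∀ x ∈ frontier Ω, (t, x) ∉ openCylinder Ω τ := fun t x hx hmem =>
    hx.2 (by rw [hΩ.interior_eq]; exact hmem.2)
  have h0 : ∀ x, ((0 : ℝ), x) ∉ openCylinder Ω τ := fun x hmem => lt_irrefl _ hmem.1.1
  have h1 : ∀ x, (τ, x) ∉ openCylinder Ω τ := fun x hmem => lt_irrefl _ hmem.1.2
  exact
  { regular_u := fun i => velocityRegular_ofSpaceTime (ha i).contDiff
    regular_w := fun i => velocityRegular_ofSpaceTime (hb i).contDiff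
    regular_p := (velocityRegular_ofSpaceTime hq.contDiff).pressureRegular
    regular_r := (velocityRegular_ofSpaceTime hr.contDiff).pressureRegular
    boundary_u := fun i t _ x hx => (ha i).eq_zero (hfr t x hx)
    boundary_w := fun i t _ x hx => (hb i).eq_zero (hfr t x hx)
    initial_u := fun i x _ => (ha i).eq_zero (h0 x)
    initial_w := fun i x _ => (hb i).eq_zero (h0 x)
    final := fun i x _ => ((ha i).eq_zero (h1 x)).trans ((hb i).eq_zero (h1 x)).symm
    boundary_pressure := fun t _ x hx =>
      (hq.eq_zero (hfr t x hx)).trans (hr.eq_zero (hfr t x hx)).symm }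

/-- The fundamental lemma of the calculus of variations on the cylinder. -/
theorem eq_zero_of_integral_test (hΩ : IsOpen Ω) (hb : Bornology.IsBounded Ω) {F : ScalarField}
    (hF : ExtendsContinuously Ω τ F)
    (h : ∀ χ, IsTestFunction Ω τ χ → ∫ y in openCylinder Ω τ, χ y * F y.1 y.2 = 0) :
    ∀ t ∈ Ioo 0 τ, ∀ x ∈ Ω, F t x = 0 := by
  have hU := isOpen_openCylinder (τ := τ) hΩ
  have hae := hU.ae_eq_zero_of_integral_contDiff_smul_eq_zero (μ := volume)
    (f := fun y : ℝ × Space => F y.1 y.2) (hF.integrableOn hΩ hb).locallyIntegrableOn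
    fun χ hχ _ hs => by
      rw [← h χ ⟨hχ, hs⟩, setIntegral_eq_integral_of_forall_compl_eq_zero]
      · rfl
      · intro y hy
        rw [IsTestFunction.eq_zero ⟨hχ, hs⟩ hy, zero_mul]
  have hae' : (fun y : ℝ × Space => F y.1 y.2) =ᵐ[volume.restrict (openCylinder Ω τ)]
      fun _ => (0 : ℝ) := (ae_restrict_iff' hU.measurableSet).mpr hae
  have := Measure.eqOn_open_of_ae_eq hae' hU hF.continuousOn continuousOn_const
  exact fun t ht x hx => this (show (t, x) ∈ openCylinder Ω τ from ⟨ht, hx⟩)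

variable {ν : ℝ} {f : VectorField} {g : Fin 3 → Space → ℝ} {z : Fields}

/-- Varying `p` and `r` gives the two divergence equations; varying a single component of `u` or `w`
gives a momentum residual. Conversely, the system makes the integrated density vanish pointwise. -/
theorem isStationaryPoint_iff_eulerLagrange (hΩ : IsOpen Ω) (hb : Bornology.IsBounded Ω)
    (hτ : 0 < τ) (hz : Admissible Ω τ f g z) :
    IsStationaryPoint Ω ν τ f g z ↔ EulerLagrange Ω ν τ z := by
  rw [isStationaryPoint_iff_firstVariation hΩ hb hτ ν hz]
  constructor
  · intro hs
    have hs' : ∀ a q b r, (∀ i, IsTestFunction Ω τ (a i)) → IsTestFunction Ω τ q →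
        (∀ i, IsTestFunction Ω τ (b i)) → IsTestFunction Ω τ r →
        ∫ y in openCylinder Ω τ, variationDensity ν z (variationOf a q b r) y.1 y.2 = 0 :=
      fun a q b r ha hq hb' hr => by
        have hh := admissibleVariation_variationOf hΩ ha hq hb' hr
        rw [← firstVariation_eq hΩ hb hτ ν hz hh, hs _ hh]
    have h0 := IsTestFunction.zero (Ω := Ω) (τ := τ)
    have hp : ∀ t ∈ Ioo 0 τ, ∀ x ∈ Ω, ∑ i, dx i (z.u i) t x = 0 := by
      refine eq_zero_of_integral_test hΩ hb (.sum fun i => (hz.regular_u i).extends_dx i) ?_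
      intro χ hχ
      have := hs' (fun _ _ => 0) χ (fun _ _ => 0) (fun _ => 0) (fun _ => h0) hχ (fun _ => h0) h0
      simp only [variationDensity, variationOf, Fields.u, Fields.p, Fields.w, Fields.r,
        ofSpaceTime, zero_mul, sub_self, mul_zero, Finset.sum_const_zero, zero_sub, add_zero, integral_neg, neg_eq_zero] at this
      simpa only [mul_comm] using this
    have hr : ∀ t ∈ Ioo 0 τ, ∀ x ∈ Ω, ∑ i, dx i (z.w i) t x = 0 := by
      refine eq_zero_of_integral_test hΩ hb (.sum fun i => (hz.regular_w i).extends_dx i) ?_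
      intro χ hχ
      have := hs' (fun _ _ => 0) (fun _ => 0) (fun _ _ => 0) χ (fun _ => h0) h0 (fun _ => h0) hχ
      simp only [variationDensity, variationOf, Fields.u, Fields.p, Fields.w, Fields.r,
        ofSpaceTime, zero_mul, sub_self, mul_zero, Finset.sum_const_zero, zero_add] at this
      simpa only [mul_comm] using this
    have hsingle : ∀ (k : Fin 3) {χ : ℝ × Space → ℝ}, IsTestFunction Ω τ χ →
        ∀ i, IsTestFunction Ω τ (fun y => if i = k then χ y else 0) := fun k χ hχ i => by
      by_cases h : i = k
      · simpa [h] using hχ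
      · simpa [h] using h0
    have hu : ∀ k, ∀ t ∈ Ioo 0 τ, ∀ x ∈ Ω, momentumResidual ν z.u z.p z.w k t x = 0 := by
      intro k
      refine eq_zero_of_integral_test hΩ hb
        (extends_momentumResidual hz.regular_u hz.regular_w hz.regular_p k) ?_
      intro χ hχ
      have := hs' (fun i y => if i = k then χ y else 0) (fun _ => 0) (fun _ _ => 0) (fun _ => 0)
        (hsingle k hχ) h0 (fun _ => h0) h0
      simpa [variationDensity, variationOf, Fields.u, Fields.p, Fields.w, Fields.r, ofSpaceTime] using this
    have hw : ∀ k, ∀ t ∈ Ioo 0 τ, ∀ x ∈ Ω, momentumResidual ν z.w z.r z.u k t x = 0 := by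
      intro k
      refine eq_zero_of_integral_test hΩ hb
        (extends_momentumResidual hz.regular_w hz.regular_u hz.regular_r k) ?_
      intro χ hχ
      have := hs' (fun _ _ => 0) (fun _ => 0) (fun i y => if i = k then χ y else 0) (fun _ => 0)
        (fun _ => h0) h0 (hsingle k hχ) h0
      simpa [variationDensity, variationOf, Fields.u, Fields.p, Fields.w, Fields.r, ofSpaceTime, integral_neg] using this
    refine ⟨hp, hr, fun i t ht x hx => ?_, fun i t ht x hx => ?_⟩
    · have := hu i t ht x hx
      -- The residual contains an extra multiple of the divergence of `w`, created by moving `∂_j`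
      -- off `δu_i`; it drops out by the equation obtained from `δr`.
      rw [momentumResidual, hr t ht x hx] at this
      linarith
    · have := hw i t ht x hx
      rw [momentumResidual, hp t ht x hx] at this
      linarith
  · intro hE h hh
    rw [firstVariation_eq hΩ hb hτ ν hz hh]
    refine setIntegral_eq_zero_of_forall_eq_zero fun y hy => ?_
    have hu : ∀ i, momentumResidual ν z.u z.p z.w i y.1 y.2 = 0 := fun i => by
      have := hE.eq_u i y.1 hy.1 y.2 hy.2
      rw [momentumResidual, hE.eq_r y.1 hy.1 y.2 hy.2]
      linarith
    have hw : ∀ i, momentumResidual ν z.w z.r z.u i y.1 y.2 = 0 := fun i => by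
      have := hE.eq_w i y.1 hy.1 y.2 hy.2
      rw [momentumResidual, hE.eq_p y.1 hy.1 y.2 hy.2]
      linarith
    simp [variationDensity, hu, hw, hE.eq_r y.1 hy.1 y.2 hy.2, hE.eq_p y.1 hy.1 y.2 hy.2]

end

/-! ### The energy estimate -/

/-- Grönwall's inequality for a function vanishing at the left end point. -/
theorem nonpos_of_deriv_le_mul {τ K : ℝ} {E E' : ℝ → ℝ} (hE : ContinuousOn E (Icc 0 τ))
    (hd : ∀ t ∈ Ioo 0 τ, HasDerivAt E (E' t) t) (hle : ∀ t ∈ Ioo 0 τ, E' t ≤ K * E t)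
    (h0 : E 0 = 0) : ∀ t ∈ Icc 0 τ, E t ≤ 0 := by
  intro t ht
  have hg : ∀ r ∈ Ioo 0 τ, HasDerivAt (fun r => Real.exp (-K * r) * E r)
      (Real.exp (-K * r) * (E' r - K * E r)) r := fun r hr => by
    have h1 : HasDerivAt (fun r => Real.exp (-K * r)) (Real.exp (-K * r) * -K) r := by
      simpa using ((hasDerivAt_id r).const_mul (-K)).exp
    refine (h1.mul (hd r hr)).congr_deriv ?_
    ring
  have hanti : AntitoneOn (fun r => Real.exp (-K * r) * E r) (Icc 0 τ) := by
    refine antitoneOn_of_deriv_nonpos (convex_Icc 0 τ) ?_ ?_ ?_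
    · exact ContinuousOn.mul (by fun_prop) hE
    · rw [interior_Icc]
      exact fun r hr => (hg r hr).differentiableAt.differentiableWithinAt
    · rw [interior_Icc]
      intro r hr
      rw [(hg r hr).deriv]
      exact mul_nonpos_of_nonneg_of_nonpos (Real.exp_pos _).le (by linarith [hle r hr])
  have := hanti (left_mem_Icc.mpr (ht.1.trans ht.2)) ht ht.1
  simp only [h0, mul_zero] at this
  exact nonpos_of_mul_nonpos_right this (Real.exp_pos _)

/-- The pointwise estimate behind the energy inequality. -/
theorem energy_density_le {ν C : ℝ} (hν : 0 < ν) {d r : Fin 3 → ℝ} {G : Fin 3 → Fin 3 → ℝ}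
    (hr : ∀ i, |r i| ≤ C * ∑ j, (|d j| + ∑ k, |G j k|)) :
    (∑ i, 2 * d i * r i) - 2 * ν * ∑ i, ∑ j, G i j * G i j ≤
      (3 * (2 * |C| + 9 * C ^ 2 / (2 * ν))) * ∑ i, d i ^ 2 := by
  set S := ∑ i, |d i| with hS
  set B := ∑ j, ∑ k, |G j k| with hB
  have hS0 : 0 ≤ S := Finset.sum_nonneg fun _ _ => abs_nonneg _
  have hB0 : 0 ≤ B := Finset.sum_nonneg fun _ _ => Finset.sum_nonneg fun _ _ => abs_nonneg _
  have hS2 : S ^ 2 ≤ 3 * ∑ i, d i ^ 2 := by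
    have := sq_sum_le_card_mul_sum_sq (s := Finset.univ) (f := fun i => |d i|)
    simpa using this
  have hB2 : B ^ 2 ≤ 9 * ∑ i, ∑ j, G i j * G i j := by
    have := sq_sum_le_card_mul_sum_sq (s := (Finset.univ : Finset (Fin 3 × Fin 3)))
      (f := fun y => |G y.1 y.2|)
    rw [Fintype.sum_prod_type, Fintype.sum_prod_type] at this
    norm_num at this
    simpa only [hB, pow_two] using this
  have h1 : ∑ i, 2 * d i * r i ≤ 2 * S * (C * (S + B)) := by
    have e : 2 * S * (C * (S + B)) = ∑ i, 2 * |d i| * (C * (S + B)) := by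
      rw [← Finset.sum_mul, ← Finset.mul_sum]
    rw [e]
    refine Finset.sum_le_sum fun i _ => ?_
    have e2 := hr i
    rw [Finset.sum_add_distrib] at e2
    calc 2 * d i * r i ≤ |2 * d i * r i| := le_abs_self _
      _ = 2 * |d i| * |r i| := by rw [abs_mul, abs_mul, abs_two]
      _ ≤ 2 * |d i| * (C * (S + B)) := by gcongr
  -- Young's inequality, weighted so that the gradient part is absorbed exactly by the dissipation:
  -- by Cauchy–Schwarz over nine entries, `2 * ν / 9 * B ^ 2` is at most the viscous term.
  have h2 : 2 * C * S * B ≤ 2 * ν / 9 * B ^ 2 + 9 * C ^ 2 / (2 * ν) * S ^ 2 := by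
    have : 0 ≤ (2 * ν / 9 * B - C * S) ^ 2 / (2 * ν / 9) := by positivity
    have e : (2 * ν / 9 * B - C * S) ^ 2 / (2 * ν / 9) =
        2 * ν / 9 * B ^ 2 + 9 * C ^ 2 / (2 * ν) * S ^ 2 - 2 * C * S * B := by
      field_simp
      ring
    linarith
  have h3 : 2 * C * S ^ 2 ≤ 2 * |C| * S ^ 2 := by
    gcongr
    exact le_abs_self C
  have h4 : 2 * ν / 9 * B ^ 2 ≤ 2 * ν * ∑ i, ∑ j, G i j * G i j := by
    have := mul_le_mul_of_nonneg_left hB2 (show 0 ≤ 2 * ν / 9 by positivity)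
    linarith
  have h5 : (2 * |C| + 9 * C ^ 2 / (2 * ν)) * S ^ 2 ≤
      (2 * |C| + 9 * C ^ 2 / (2 * ν)) * (3 * ∑ i, d i ^ 2) := by gcongr
  linarith

section

variable {Ω : Set Space} {τ ν σ C : ℝ} {d : VectorField} {q : ScalarField}

/-- The kinetic energy (up to a factor) of a velocity field. -/
def energy (Ω : Set Space) (d : VectorField) (t : ℝ) : ℝ := ∫ x in Ω, ∑ i, d i t x ^ 2

/-- Continuity up to both end points lets the initial or final data enter Grönwall's inequality,
although the energy is differentiated only inside the interval. -/
theorem continuousOn_energy (hΩ : IsOpen Ω) (hb : Bornology.IsBounded Ω)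
    (hd : ∀ i, VelocityRegular Ω τ (d i)) : ContinuousOn (energy Ω d) (Icc 0 τ) := by
  have hc : ContinuousOn (fun y : ℝ × Space => ∑ i, d i y.1 y.2 ^ 2) (closedCylinder Ω τ) :=
    continuousOn_finsetSum _ fun i _ => (hd i).continuousOn.pow 2
  obtain ⟨B, hB⟩ := (isCompact_closedCylinder hb).exists_bound_of_continuousOn hc
  have hfin : IsFiniteMeasure (volume.restrict Ω) := ⟨by simpa using hb.measure_lt_top⟩
  refine continuousOn_of_dominated (bound := fun _ => B) (fun t ht => ?_) (fun t ht => ?_)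
    (integrable_const _) ?_
  · refine ContinuousOn.aestronglyMeasurable ?_ hΩ.measurableSet
    exact hc.comp (f := fun x => (t, x)) (by fun_prop) fun x hx => ⟨ht, subset_closure hx⟩
  · refine (ae_restrict_iff' hΩ.measurableSet).mpr (.of_forall fun x hx => ?_)
    exact hB (t, x) ⟨ht, subset_closure hx⟩
  · refine (ae_restrict_iff' hΩ.measurableSet).mpr (.of_forall fun x hx => ?_)
    exact hc.comp (f := fun t => (t, x)) (by fun_prop) fun t ht => ⟨ht, subset_closure hx⟩

theorem hasDerivAt_energy (hΩ : IsOpen Ω) (hb : Bornology.IsBounded Ω)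
    (hd : ∀ i, VelocityRegular Ω τ (d i)) {t : ℝ} (ht : t ∈ Ioo 0 τ) :
    HasDerivAt (energy Ω d) (∫ x in Ω, ∑ i, 2 * d i t x * dt (d i) t x) t := by
  have x0 : ExtendsContinuously Ω τ fun t x => ∑ i, d i t x ^ 2 :=
    .sum fun i => (hd i).interiorC1.extends_self.pow 2
  have x1 : ExtendsContinuously Ω τ fun t x => ∑ i, 2 * d i t x * dt (d i) t x :=
    .sum fun i => ((ExtendsContinuously.const 2).mul (hd i).interiorC1.extends_self).mul
      (hd i).extends_dt
  obtain ⟨B, -, hB⟩ := x1.exists_bound hb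
  have hfin : IsFiniteMeasure (volume.restrict Ω) := ⟨by simpa using hb.measure_lt_top⟩
  refine (hasDerivAt_integral_of_dominated_loc_of_deriv_le (μ := volume.restrict Ω)
    (F := fun t x => ∑ i, d i t x ^ 2) (F' := fun t x => ∑ i, 2 * d i t x * dt (d i) t x)
    (bound := fun _ => B) (isOpen_Ioo.mem_nhds ht) ?_ (x0.integrableOn_slice hΩ hb ht)
    (x1.integrableOn_slice hΩ hb ht).aestronglyMeasurable ?_ (integrable_const _) ?_).2
  · filter_upwards [isOpen_Ioo.mem_nhds ht] with r hr
    exact (x0.integrableOn_slice hΩ hb hr).aestronglyMeasurable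
  · exact (ae_restrict_iff' hΩ.measurableSet).mpr (.of_forall fun x hx r hr => hB r hr x hx)
  · refine (ae_restrict_iff' hΩ.measurableSet).mpr (.of_forall fun x hx r hr => ?_)
    refine HasDerivAt.fun_sum fun i _ => ?_
    have := ((hd i).differentiableAt r hr x hx).hasDerivAt.pow 2
    refine this.congr_deriv ?_
    simp [dt]

/-- The energy inequality for a perturbed Stokes system, forward (`σ = 1`) or backward (`σ = -1`) in
time. -/
theorem energy_deriv_le (hΩ : IsOpen Ω) (hb : Bornology.IsBounded Ω) (hν : 0 < ν)
    (hd : ∀ i, VelocityRegular Ω τ (d i)) (hq : PressureRegular Ω τ q)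
    (h0 : ∀ i, ∀ t ∈ Icc 0 τ, ∀ x ∈ frontier Ω, d i t x = 0)
    (hdiv : ∀ t ∈ Ioo 0 τ, ∀ x ∈ Ω, ∑ i, dx i (d i) t x = 0)
    (hR : ∀ i, ∀ t ∈ Ioo 0 τ, ∀ x ∈ Ω,
      |σ * dt (d i) t x - ν * laplacian (d i) t x + dx i q t x| ≤
        C * ∑ j, (|d j t x| + ∑ k, |dx k (d j) t x|))
    {t : ℝ} (ht : t ∈ Ioo 0 τ) :
    σ * (∫ x in Ω, ∑ i, 2 * d i t x * dt (d i) t x) ≤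
      3 * (2 * |C| + 9 * C ^ 2 / (2 * ν)) * energy Ω d t := by
  have d0 := fun i => (hd i).interiorC1.extends_self
  have d1 := fun i => (hd i).extends_dx
  have d2 := fun i => (hd i).extends_dxdx
  have dtt := fun i => (hd i).extends_dt
  have q0 := hq.interiorC1.extends_self
  have q1 := hq.extends_dx
  have xF : ExtendsContinuously Ω τ fun t x => ∑ i, 2 * d i t x * dt (d i) t x :=
    .sum fun i => ((ExtendsContinuously.const 2).mul (d0 i)).mul (dtt i)
  have xZ := fun i j => ((d1 i j).mul (d1 i j)).add ((d0 i).mul (d2 i j j))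
  have xP := fun i => ((d1 i i).mul q0).add ((d0 i).mul (q1 i))
  have xE : ExtendsContinuously Ω τ fun t x => ∑ i, d i t x ^ 2 := .sum fun i => (d0 i).pow 2
  have hZ : ∫ x in Ω, ∑ i, ∑ j, (dx j (d i) t x * dx j (d i) t x
      + d i t x * dx j (dx j (d i)) t x) = 0 := by
    rw [integral_finsetSum _ fun i _ =>
      (ExtendsContinuously.sum (s := Finset.univ) (xZ i)).integrableOn_slice hΩ hb ht]
    refine Finset.sum_eq_zero fun i _ => ?_
    rw [integral_finsetSum _ fun j _ => (xZ i j).integrableOn_slice hΩ hb ht]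
    exact Finset.sum_eq_zero fun j _ => setIntegral_slice_dx_mul_add hΩ hb
      (hd i).pressureRegular ((hd i).interiorC1_dx hΩ j) ht (h0 i t (Ioo_subset_Icc_self ht)) j
  have hP : ∫ x in Ω, ∑ i, (dx i (d i) t x * q t x + d i t x * dx i q t x) = 0 := by
    rw [integral_finsetSum _ fun i _ => (xP i).integrableOn_slice hΩ hb ht]
    exact Finset.sum_eq_zero fun i _ => setIntegral_slice_dx_mul_add hΩ hb
      (hd i).pressureRegular hq.interiorC1 ht (h0 i t (Ioo_subset_Icc_self ht)) i
  have iF := xF.integrableOn_slice hΩ hb ht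
  have iZ := (ExtendsContinuously.sum (s := Finset.univ) fun i =>
    ExtendsContinuously.sum (s := Finset.univ) (xZ i)).integrableOn_slice hΩ hb ht
  have iP := (ExtendsContinuously.sum (s := Finset.univ) xP).integrableOn_slice hΩ hb ht
  have iE := xE.integrableOn_slice hΩ hb ht
  have jZ : IntegrableOn (fun x => σ * (∑ i, 2 * d i t x * dt (d i) t x)
      - 2 * ν * ∑ i, ∑ j, (dx j (d i) t x * dx j (d i) t x
        + d i t x * dx j (dx j (d i)) t x)) Ω := (iF.const_mul σ).sub (iZ.const_mul (2 * ν))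
  -- Adding the two null integrals `hZ` and `hP` turns the integrand into `2 d · (σ ∂_t d - ν Δd +
  -- ∇q) - 2 ν |∇d|²`, once `div d = 0` is used.
  have e : σ * (∫ x in Ω, ∑ i, 2 * d i t x * dt (d i) t x) =
      ∫ x in Ω, (σ * (∑ i, 2 * d i t x * dt (d i) t x)
      - 2 * ν * (∑ i, ∑ j, (dx j (d i) t x * dx j (d i) t x + d i t x * dx j (dx j (d i)) t x))
      + 2 * ∑ i, (dx i (d i) t x * q t x + d i t x * dx i q t x)) := by
    rw [integral_add jZ (iP.const_mul 2), integral_sub (iF.const_mul σ) (iZ.const_mul (2 * ν)),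
      integral_const_mul, integral_const_mul, integral_const_mul, hZ, hP]
    ring
  rw [e, energy, ← integral_const_mul]
  refine setIntegral_mono_on (jZ.add (iP.const_mul 2)) (iE.const_mul _) hΩ.measurableSet
    fun x hx => ?_
  refine le_trans (le_of_eq ?_) (energy_density_le hν (G := fun i j => dx j (d i) t x)
    fun i => hR i t ht x hx)
  have hdivx := hdiv t ht x hx
  simp only [laplacian, Finset.sum_add_distrib, ← Finset.sum_mul, hdivx, zero_mul, zero_add]
  simp only [mul_add, mul_sub, Finset.sum_add_distrib, Finset.sum_sub_distrib, Finset.mul_sum]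
  simp only [mul_assoc, mul_left_comm]
  ring

/-- A solution of a perturbed Stokes system with zero boundary values and vanishing initial
(`σ = 1`) or final (`σ = -1`) values vanishes. -/
theorem eq_zero_of_perturbed_stokes (hΩ : IsOpen Ω) (hb : Bornology.IsBounded Ω) (hν : 0 < ν)
    (hd : ∀ i, VelocityRegular Ω τ (d i)) (hq : PressureRegular Ω τ q)
    (h0 : ∀ i, ∀ t ∈ Icc 0 τ, ∀ x ∈ frontier Ω, d i t x = 0)
    (hdiv : ∀ t ∈ Ioo 0 τ, ∀ x ∈ Ω, ∑ i, dx i (d i) t x = 0)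
    (hR : ∀ i, ∀ t ∈ Ioo 0 τ, ∀ x ∈ Ω,
      |σ * dt (d i) t x - ν * laplacian (d i) t x + dx i q t x| ≤
        C * ∑ j, (|d j t x| + ∑ k, |dx k (d j) t x|))
    (hσ : (σ = 1 ∧ ∀ i, ∀ x ∈ Ω, d i 0 x = 0) ∨ (σ = -1 ∧ ∀ i, ∀ x ∈ Ω, d i τ x = 0)) :
    ∀ i, ∀ t ∈ Ioo 0 τ, ∀ x ∈ Ω, d i t x = 0 := by
  intro i t ht x hx
  have hc := continuousOn_energy hΩ hb hd
  have hder := fun t (ht : t ∈ Ioo 0 τ) => hasDerivAt_energy hΩ hb hd ht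
  have hle := fun t (ht : t ∈ Ioo 0 τ) => energy_deriv_le hΩ hb hν hd hq h0 hdiv hR ht
  have hE : energy Ω d t ≤ 0 := by
    rcases hσ with ⟨rfl, hi⟩ | ⟨rfl, hi⟩
    · refine nonpos_of_deriv_le_mul hc hder (fun t ht => by simpa using hle t ht) ?_ t
        (Ioo_subset_Icc_self ht)
      exact setIntegral_eq_zero_of_forall_eq_zero fun x hx => by simp [hi _ x hx]
    -- The backward case is the forward one for the reversed time `r ↦ τ - r`.
    · have hmem : ∀ r ∈ Ioo 0 τ, τ - r ∈ Ioo 0 τ := fun r hr => ⟨by linarith [hr.2], by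
        linarith [hr.1]⟩
      have := nonpos_of_deriv_le_mul (E := fun r => energy Ω d (τ - r))
        (E' := fun r => -∫ x in Ω, ∑ i, 2 * d i (τ - r) x * dt (d i) (τ - r) x)
        (hc.comp (by fun_prop) fun r hr => ⟨by linarith [hr.2], by linarith [hr.1]⟩)
        (fun r hr =>
          ((hder _ (hmem r hr)).comp r ((hasDerivAt_id r).const_sub τ)).congr_deriv
            (by simp))
        (fun r hr => by simpa using hle _ (hmem r hr))
        (by
          simp only [sub_zero]
          exact setIntegral_eq_zero_of_forall_eq_zero fun x hx => by simp [hi _ x hx])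
        (τ - t) (Ioo_subset_Icc_self (hmem t ht))
      simpa using this
  have xE : ExtendsContinuously Ω τ fun t x => ∑ i, d i t x ^ 2 :=
    .sum fun i => (hd i).interiorC1.extends_self.pow 2
  have hnn : ∀ x, 0 ≤ ∑ i, d i t x ^ 2 := fun x => Finset.sum_nonneg fun _ _ => sq_nonneg _
  have hE0 : ∫ x in Ω, ∑ i, d i t x ^ 2 = 0 := le_antisymm hE (integral_nonneg hnn)
  rw [integral_eq_zero_iff_of_nonneg hnn (xE.integrableOn_slice hΩ hb ht)] at hE0
  have := Measure.eqOn_open_of_ae_eq hE0 hΩ (xE.continuousOn_slice ht) continuousOn_const hx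
  have h2 := (Finset.sum_eq_zero_iff_of_nonneg fun _ _ => sq_nonneg _).mp this i
    (Finset.mem_univ i)
  exact pow_eq_zero_iff (two_ne_zero) |>.mp h2

end

/-! ### Stationary points -/

theorem eq_zero_of_apply_single_eq_zero {L : Space →L[ℝ] ℝ}
    (h : ∀ j, L (EuclideanSpace.single j (1 : ℝ)) = 0) : L = 0 := by
  refine ContinuousLinearMap.coe_injective ?_
  refine (EuclideanSpace.basisFun (Fin 3) ℝ).toBasis.ext fun j => ?_
  simpa using h j

/-- Bound for the lower order terms in the equation for a difference of solutions. -/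
theorem abs_sum_lower_order_le {M : ℝ} {α d m : Fin 3 → ℝ} {G : Fin 3 → Fin 3 → ℝ}
    (hα : ∀ j, |α j| ≤ 2 * M) (hm : ∀ j, |m j| ≤ M) (i : Fin 3) :
    |∑ j, (α j * d j + m j * (G i j + G j i))| ≤ 2 * M * ∑ j, (|d j| + ∑ k, |G j k|) := by
  have hM : 0 ≤ M := (abs_nonneg _).trans (hm 0)
  have h1 : ∑ j, |G i j| ≤ ∑ j, ∑ k, |G j k| :=
    Finset.single_le_sum (f := fun i => ∑ j, |G i j|)
      (fun i _ => Finset.sum_nonneg fun _ _ => abs_nonneg _) (Finset.mem_univ i)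
  have h2 : ∑ j, |G j i| ≤ ∑ j, ∑ k, |G j k| := Finset.sum_le_sum fun j _ =>
    Finset.single_le_sum (f := fun i => |G j i|) (fun i _ => abs_nonneg _) (Finset.mem_univ i)
  have h3 : |∑ j, (α j * d j + m j * (G i j + G j i))| ≤
      ∑ j, (2 * M * |d j| + M * (|G i j| + |G j i|)) := by
    refine (Finset.abs_sum_le_sum_abs _ _).trans (Finset.sum_le_sum fun j _ => ?_)
    refine (abs_add_le _ _).trans (add_le_add ?_ ?_)
    · rw [abs_mul]
      exact mul_le_mul_of_nonneg_right (hα j) (abs_nonneg _)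
    · rw [abs_mul]
      exact mul_le_mul (hm j) (abs_add_le _ _) (abs_nonneg _) hM
  refine h3.trans ?_
  simp only [mul_add, Finset.sum_add_distrib, ← Finset.mul_sum]
  linarith [mul_le_mul_of_nonneg_left h1 hM, mul_le_mul_of_nonneg_left h2 hM]

section

variable {Ω : Set Space} {τ ν : ℝ} {f : VectorField} {g : Fin 3 → Space → ℝ} {z z' : Fields}

theorem exists_common_bound (hb : Bornology.IsBounded Ω) {ι : Type*} [Fintype ι]
    {Φ : ι → ScalarField} (h : ∀ i, ExtendsContinuously Ω τ (Φ i)) :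
    ∃ M, 0 ≤ M ∧ ∀ i, ∀ t ∈ Ioo 0 τ, ∀ x ∈ Ω, |Φ i t x| ≤ M := by
  choose B hB0 hB using fun i => (h i).exists_bound hb
  exact ⟨∑ i, B i, Finset.sum_nonneg fun i _ => hB0 i, fun i t ht x hx => (hB i t ht x hx).trans
    (Finset.single_le_sum (fun i _ => hB0 i) (Finset.mem_univ i))⟩

/-- A pressure with vanishing gradient depends on time only. -/
theorem PressureRegular.eq_of_dx_eq_zero {q : ScalarField} (hΩ : IsOpen Ω)
    (hc : IsConnected Ω) (hq : PressureRegular Ω τ q) {t : ℝ} (ht : t ∈ Ioo 0 τ)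
    (h : ∀ j, ∀ x ∈ Ω, dx j q t x = 0) {x y : Space} (hx : x ∈ Ω) (hy : y ∈ Ω) :
    q t x = q t y :=
  hΩ.is_const_of_fderiv_eq_zero (𝕜 := ℝ) hc.isPreconnected
    ((hq.contDiffOn t ht).differentiableOn one_ne_zero)
    (fun _ hx => eq_zero_of_apply_single_eq_zero fun j => h j _ hx) hx hy

/-- With `d = u - w` and `m = (u + w) / 2`, subtracting the momentum equations gives `-∂_t d_i - ν
Δd_i + ∂_i (p - r) = m_j (∂_j d_i + ∂_i d_j)`. This is parabolic in reversed time, so the condition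
`u = w` at `t = τ` acts as zero initial data for it. -/
theorem EulerLagrange.u_eq_w (hΩ : IsOpen Ω) (hb : Bornology.IsBounded Ω) (hν : 0 < ν)
    (hz : Admissible Ω τ f g z) (hE : EulerLagrange Ω ν τ z) :
    ∀ i, ∀ t ∈ Ioo 0 τ, ∀ x ∈ Ω, z.u i t x = z.w i t x := by
  have hd : ∀ i, VelocityRegular Ω τ (z.u i + (-1 : ℝ) • z.w i) := fun i =>
    (hz.regular_u i).add_smul hΩ (hz.regular_w i) (-1)
  have hq := hz.regular_p.add_smul hΩ hz.regular_r (-1)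
  have dd : ∀ i j, ∀ t ∈ Ioo 0 τ, ∀ x ∈ Ω, dx j (z.u i + (-1 : ℝ) • z.w i) t x =
      dx j (z.u i) t x + (-1) * dx j (z.w i) t x := fun i j t ht x hx =>
    dx_add_smul ((hz.regular_u i).interiorC1.differentiableAt hΩ ht hx)
      ((hz.regular_w i).interiorC1.differentiableAt hΩ ht hx) _
  obtain ⟨M, hM, hMb⟩ := exists_common_bound (τ := τ) hb (Φ := fun j t x =>
    (z.u j t x + z.w j t x) / 2) fun j => ((hz.regular_u j).interiorC1.extends_self.add
      (hz.regular_w j).interiorC1.extends_self).div_const 2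
  have key := eq_zero_of_perturbed_stokes (σ := -1) (C := 2 * M) hΩ hb hν hd hq ?_ ?_ ?_
    (.inr ⟨rfl, fun i x hx => ?_⟩)
  · intro i t ht x hx
    have : z.u i t x + (-1) * z.w i t x = 0 := key i t ht x hx
    linarith
  · intro i t ht x hx
    change z.u i t x + (-1) * z.w i t x = 0
    rw [hz.boundary_u i t ht x hx, hz.boundary_w i t ht x hx]
    ring
  · intro t ht x hx
    simp only [dd _ _ t ht x hx, Finset.sum_add_distrib, ← Finset.mul_sum,
      hE.eq_p t ht x hx, hE.eq_r t ht x hx]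
    ring
  · intro i t ht x hx
    have e1 := hE.eq_u i t ht x hx
    have e2 := hE.eq_w i t ht x hx
    -- The difference equation has only first order terms in `d` on the right, hence `α = 0`.
    have hle := abs_sum_lower_order_le (M := M) (α := 0) (m := fun j =>
      (z.u j t x + z.w j t x) / 2) (d := fun j => (z.u j + (-1 : ℝ) • z.w j) t x)
      (G := fun i j => dx j (z.u i + (-1 : ℝ) • z.w i) t x) (by simpa using hM)
      (fun j => hMb j t ht x hx) i
    refine le_trans (le_of_eq (congrArg _ ?_)) hle
    rw [dt_add_smul ((hz.regular_u i).differentiableAt t ht x hx)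
      ((hz.regular_w i).differentiableAt t ht x hx),
      VelocityRegular.laplacian_add_smul hΩ (hz.regular_u i) (hz.regular_w i) _ ht hx,
      dx_add_smul (hz.regular_p.interiorC1.differentiableAt hΩ ht hx)
        (hz.regular_r.interiorC1.differentiableAt hΩ ht hx)]
    simp only [dd _ _ t ht x hx, Fin.sum_univ_three, Pi.zero_apply] at e1 e2 ⊢
    linear_combination e2 - e1
  · change z.u i τ x + (-1) * z.w i τ x = 0
    rw [hz.final i x hx]
    ring

/-- At a stationary point the two velocities satisfy a single system. -/
theorem EulerLagrange.reduced (hΩ : IsOpen Ω)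
    (hE : EulerLagrange Ω ν τ z) (h : ∀ i, ∀ t ∈ Ioo 0 τ, ∀ x ∈ Ω, z.u i t x = z.w i t x)
    (i : Fin 3) {t : ℝ} (ht : t ∈ Ioo 0 τ) {x : Space} (hx : x ∈ Ω) :
    ν * laplacian (z.u i) t x - dx i z.p t x = dt (z.u i) t x
      + ∑ j, z.u j t x * (dx j (z.u i) t x + dx i (z.u j) t x) := by
  have e1 : ∀ i j, dx j (z.w i) t x = dx j (z.u i) t x := fun i j =>
    dx_congr hΩ (fun y hy => (h i t ht y hy).symm) j hx
  have e2 : dt (z.w i) t x = dt (z.u i) t x := dt_congr ht fun r hr => (h i r hr x hx).symm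
  rw [hE.eq_u i t ht x hx, e2]
  simp only [e1, ← h _ t ht x hx, add_self_div_two]

/-- Once the velocities agree, the momentum equations give equal pressure gradients. Connectedness
makes `p - r` constant in space, and its zero boundary values fix the constant. -/
theorem EulerLagrange.p_eq_r (hΩ : IsOpen Ω) (hc : IsConnected Ω) (hb : Bornology.IsBounded Ω)
    (hz : Admissible Ω τ f g z) (hE : EulerLagrange Ω ν τ z)
    (h : ∀ i, ∀ t ∈ Ioo 0 τ, ∀ x ∈ Ω, z.u i t x = z.w i t x) :
    ∀ t ∈ Ioo 0 τ, ∀ x ∈ Ω, z.p t x = z.r t x := by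
  intro t ht x hx
  have hq := hz.regular_p.add_smul hΩ hz.regular_r (-1)
  have hdx : ∀ j, ∀ x ∈ Ω, dx j (z.p + (-1 : ℝ) • z.r) t x = 0 := by
    intro i x hx
    have e1 : ∀ i j, dx j (z.w i) t x = dx j (z.u i) t x := fun i j =>
      dx_congr hΩ (fun y hy => (h i t ht y hy).symm) j hx
    have e2 : dt (z.w i) t x = dt (z.u i) t x := dt_congr ht fun r hr => (h i r hr x hx).symm
    have e3 : laplacian (z.w i) t x = laplacian (z.u i) t x :=
      Finset.sum_congr rfl fun j _ => dx_congr hΩ (fun y hy =>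
        dx_congr hΩ (fun y hy => (h i t ht y hy).symm) j hy) j hx
    have e4 := hE.eq_u i t ht x hx
    have e5 := hE.eq_w i t ht x hx
    rw [dx_add_smul (hz.regular_p.interiorC1.differentiableAt hΩ ht hx)
      (hz.regular_r.interiorC1.differentiableAt hΩ ht hx)]
    simp only [e1, e2, e3, ← h _ t ht x hx] at e4 e5
    linarith
  -- A set with empty frontier is empty or the whole space; the latter is unbounded.
  have hne : (frontier Ω).Nonempty := by
    rw [nonempty_iff_ne_empty, Ne, frontier_eq_empty_iff, not_or]
    refine ⟨hc.nonempty.ne_empty, fun hu => ?_⟩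
    rw [hu] at hb
    exact NormedSpace.unbounded_univ ℝ Space hb
  obtain ⟨y, hy⟩ := hne
  have hcont : ContinuousOn ((z.p + (-1 : ℝ) • z.r) t) (closure Ω) :=
    hq.continuousOn.comp (f := fun x => (t, x)) (by fun_prop)
      fun x hx => ⟨Ioo_subset_Icc_self ht, hx⟩
  have heq := Set.EqOn.of_subset_closure (s := Ω) (t := closure Ω)
    (fun y hy => hq.eq_of_dx_eq_zero hΩ hc ht hdx hy hx) hcont continuousOn_const subset_closure
    subset_rfl
  have h1 : z.p t y + (-1) * z.r t y = z.p t x + (-1) * z.r t x := heq hy.1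
  have h2 := hz.boundary_pressure t (Ioo_subset_Icc_self ht) y hy
  linarith

end

section

variable {Ω : Set Space} {τ ν : ℝ} {f : VectorField} {g : Fin 3 → Space → ℝ} {z z' : Fields}

theorem IsStationaryPoint.eulerLagrange (hz : IsStationaryPoint Ω ν τ f g z) (hΩ : IsOpen Ω)
    (hb : Bornology.IsBounded Ω) (hτ : 0 < τ) : EulerLagrange Ω ν τ z :=
  (isStationaryPoint_iff_eulerLagrange hΩ hb hτ hz.1).mp hz

theorem IsStationaryPoint.u_eq_w (hz : IsStationaryPoint Ω ν τ f g z) (hΩ : IsOpen Ω)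
    (hb : Bornology.IsBounded Ω) (hν : 0 < ν) (hτ : 0 < τ) :
    ∀ i, ∀ t ∈ Icc 0 τ, ∀ x ∈ closure Ω, z.u i t x = z.w i t x := fun i =>
  eq_on_closedCylinder hτ (hz.1.regular_u i).continuousOn (hz.1.regular_w i).continuousOn
    ((hz.eulerLagrange hΩ hb hτ).u_eq_w hΩ hb hν hz.1 i)

theorem IsStationaryPoint.p_eq_r (hz : IsStationaryPoint Ω ν τ f g z) (hΩ : IsOpen Ω)
    (hc : IsConnected Ω) (hb : Bornology.IsBounded Ω) (hν : 0 < ν) (hτ : 0 < τ) :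
    ∀ t ∈ Icc 0 τ, ∀ x ∈ closure Ω, z.p t x = z.r t x :=
  eq_on_closedCylinder hτ hz.1.regular_p.continuousOn hz.1.regular_r.continuousOn
    ((hz.eulerLagrange hΩ hb hτ).p_eq_r hΩ hc hb hz.1
      ((hz.eulerLagrange hΩ hb hτ).u_eq_w hΩ hb hν hz.1))

/-- The Navier-Stokes momentum equation with pressure `q + |v|²/2`, in expanded form. -/
theorem momentum_iff {v : VectorField} {q : ScalarField} {i : Fin 3} {t : ℝ} {x : Space}
    (hv : ∀ j, DifferentiableAt ℝ (v j t) x) (hq : DifferentiableAt ℝ (q t) x) :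
    (dt (v i) t x + ∑ j, v j t x * dx j (v i) t x =
      - dx i (fun s y => q s y + 1 / 2 * ∑ j, (v j s y) ^ 2) t x + ν * laplacian (v i) t x) ↔
    ν * laplacian (v i) t x - dx i q t x = dt (v i) t x
      + ∑ j, v j t x * (dx j (v i) t x + dx i (v j) t x) := by
  have hd : dx i (fun s y => q s y + 1 / 2 * ∑ j, (v j s y) ^ 2) t x =
      dx i q t x + ∑ j, v j t x * dx i (v j) t x := by
    have h1 : HasFDerivAt (fun y => q t y + 1 / 2 * ∑ j, (v j t y) ^ 2)
        (fderiv ℝ (q t) x + (1 / 2 : ℝ) • ∑ j, (2 * v j t x) • fderiv ℝ (v j t) x) x := by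
      refine hq.hasFDerivAt.add (HasFDerivAt.const_mul (HasFDerivAt.fun_sum fun j _ => ?_) _)
      simpa using (hv j).hasFDerivAt.pow 2
    simp only [dx]
    rw [h1.fderiv]
    simp only [_root_.add_apply, _root_.smul_apply, _root_.sum_apply, smul_eq_mul,
      Finset.mul_sum]
    congr 1
    exact Finset.sum_congr rfl fun j _ => by ring
  rw [hd]
  simp only [mul_add, Finset.sum_add_distrib]
  constructor <;> intro h <;> linarith

theorem IsStationaryPoint.isNavierStokesSolution (hz : IsStationaryPoint Ω ν τ f g z)
    (hΩ : IsOpen Ω) (hb : Bornology.IsBounded Ω) (hν : 0 < ν) (hτ : 0 < τ) :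
    IsNavierStokesSolution Ω ν τ f g z.u z.p where
  regular_v := hz.1.regular_u
  regular_q := hz.1.regular_p
  incompressible := (hz.eulerLagrange hΩ hb hτ).eq_p
  momentum i _ ht _ hx := (momentum_iff
    (fun j => (hz.1.regular_u j).interiorC1.differentiableAt hΩ ht hx)
    (hz.1.regular_p.interiorC1.differentiableAt hΩ ht hx)).mpr
    ((hz.eulerLagrange hΩ hb hτ).reduced hΩ
      ((hz.eulerLagrange hΩ hb hτ).u_eq_w hΩ hb hν hz.1) i ht hx)
  boundary := hz.1.boundary_u
  initial := hz.1.initial_u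

/-- On the diagonal the mean velocity is `v` itself, and both Euler–Lagrange momentum equations
reduce to the expanded form in `momentum_iff`. -/
theorem IsNavierStokesSolution.isStationaryPoint {v : VectorField} {q : ScalarField}
    (h : IsNavierStokesSolution Ω ν τ f g v q) (hΩ : IsOpen Ω) (hb : Bornology.IsBounded Ω)
    (hτ : 0 < τ) : IsStationaryPoint Ω ν τ f g (v, q, v, q) := by
  have hadm : Admissible Ω τ f g (v, q, v, q) :=
    ⟨h.regular_v, h.regular_v, h.regular_q, h.regular_q, h.boundary, h.boundary, h.initial,
      h.initial, fun _ _ _ => rfl, fun _ _ _ _ => rfl⟩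
  have hm : ∀ i, ∀ t ∈ Ioo 0 τ, ∀ x ∈ Ω, ν * laplacian (v i) t x - dx i q t x = dt (v i) t x
      + ∑ j, (v j t x + v j t x) / 2 * (dx j (v i) t x + dx i (v j) t x) := by
    intro i t ht x hx
    simp only [add_self_div_two]
    exact (momentum_iff (fun j => (h.regular_v j).interiorC1.differentiableAt hΩ ht hx)
      (h.regular_q.interiorC1.differentiableAt hΩ ht hx)).mp (h.momentum i t ht x hx)
  exact (isStationaryPoint_iff_eulerLagrange hΩ hb hτ hadm).mpr
    ⟨h.incompressible, h.incompressible, hm, hm⟩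

/-- The difference `d = v' - v` satisfies `∂_t d_i - ν Δd_i + ∂_i (q' - q) = -d_j (∂_j v'_i + ∂_i
v'_j) - v_j (∂_j d_i + ∂_i d_j)`. Bounds for `v` and for the gradient of `v'` make this a perturbed
Stokes system with zero initial data. -/
theorem IsNavierStokesSolution.velocity_unique {v v' : VectorField} {q q' : ScalarField}
    (h : IsNavierStokesSolution Ω ν τ f g v q) (h' : IsNavierStokesSolution Ω ν τ f g v' q')
    (hΩ : IsOpen Ω) (hb : Bornology.IsBounded Ω) (hν : 0 < ν) :
    ∀ i, ∀ t ∈ Ioo 0 τ, ∀ x ∈ Ω, v' i t x = v i t x := by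
  have hd : ∀ i, VelocityRegular Ω τ (v' i + (-1 : ℝ) • v i) := fun i =>
    (h'.regular_v i).add_smul hΩ (h.regular_v i) (-1)
  have hq := h'.regular_q.add_smul hΩ h.regular_q (-1)
  have dd : ∀ i j, ∀ t ∈ Ioo 0 τ, ∀ x ∈ Ω, dx j (v' i + (-1 : ℝ) • v i) t x =
      dx j (v' i) t x + (-1) * dx j (v i) t x := fun i j t ht x hx =>
    dx_add_smul ((h'.regular_v i).interiorC1.differentiableAt hΩ ht hx)
      ((h.regular_v i).interiorC1.differentiableAt hΩ ht hx) _
  obtain ⟨M₁, hM₁, hMb₁⟩ := exists_common_bound (τ := τ) hb fun j =>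
    (h.regular_v j).interiorC1.extends_self
  obtain ⟨M₂, hM₂, hMb₂⟩ := exists_common_bound (τ := τ) hb (ι := Fin 3 × Fin 3)
    (Φ := fun y => dx y.1 (v' y.2)) fun y => (h'.regular_v y.2).extends_dx y.1
  have key := eq_zero_of_perturbed_stokes (σ := 1) (C := 2 * (M₁ + M₂)) hΩ hb hν hd hq ?_ ?_ ?_
    (.inl ⟨rfl, fun i x hx => ?_⟩)
  · intro i t ht x hx
    have : v' i t x + (-1) * v i t x = 0 := key i t ht x hx
    linarith
  · intro i t ht x hx
    change v' i t x + (-1) * v i t x = 0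
    rw [h.boundary i t ht x hx, h'.boundary i t ht x hx]
    ring
  · intro t ht x hx
    simp only [dd _ _ t ht x hx, Finset.sum_add_distrib, ← Finset.mul_sum,
      h.incompressible t ht x hx, h'.incompressible t ht x hx]
    ring
  · intro i t ht x hx
    have e1 := (momentum_iff (fun j => (h.regular_v j).interiorC1.differentiableAt hΩ ht hx)
      (h.regular_q.interiorC1.differentiableAt hΩ ht hx)).mp (h.momentum i t ht x hx)
    have e2 := (momentum_iff (fun j => (h'.regular_v j).interiorC1.differentiableAt hΩ ht hx)
      (h'.regular_q.interiorC1.differentiableAt hΩ ht hx)).mp (h'.momentum i t ht x hx)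
    have hle := abs_sum_lower_order_le (M := M₁ + M₂)
      (α := fun j => -(dx j (v' i) t x + dx i (v' j) t x)) (m := fun j => -v j t x)
      (d := fun j => (v' j + (-1 : ℝ) • v j) t x)
      (G := fun i j => dx j (v' i + (-1 : ℝ) • v i) t x)
      (fun j => by
        rw [abs_neg]
        refine (abs_add_le _ _).trans ?_
        have := hMb₂ (j, i) t ht x hx
        have := hMb₂ (i, j) t ht x hx
        simp only at *
        linarith)
      (fun j => by
        rw [abs_neg]
        linarith [hMb₁ j t ht x hx]) i
    refine le_trans (le_of_eq (congrArg _ ?_)) hle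
    have hval : ∀ j, (v' j + (-1 : ℝ) • v j) t x = v' j t x + (-1) * v j t x := fun _ => rfl
    rw [dt_add_smul ((h'.regular_v i).differentiableAt t ht x hx)
      ((h.regular_v i).differentiableAt t ht x hx),
      VelocityRegular.laplacian_add_smul hΩ (h'.regular_v i) (h.regular_v i) _ ht hx,
      dx_add_smul (h'.regular_q.interiorC1.differentiableAt hΩ ht hx)
        (h.regular_q.interiorC1.differentiableAt hΩ ht hx)]
    simp only [dd _ _ t ht x hx, hval, Fin.sum_univ_three] at e1 e2 ⊢
    linear_combination e1 - e2
  · change v' i 0 x + (-1) * v i 0 x = 0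
    rw [h.initial i x hx, h'.initial i x hx]
    ring

theorem IsNavierStokesSolution.pressure_unique {v v' : VectorField} {q q' : ScalarField}
    (h : IsNavierStokesSolution Ω ν τ f g v q) (h' : IsNavierStokesSolution Ω ν τ f g v' q')
    (hΩ : IsOpen Ω) (hc : IsConnected Ω) (hb : Bornology.IsBounded Ω) (hν : 0 < ν) (hτ : 0 < τ) :
    ∃ c : ℝ → ℝ, ∀ t ∈ Icc 0 τ, ∀ x ∈ closure Ω, q' t x = q t x + c t := by
  have hv := h.velocity_unique h' hΩ hb hν
  obtain ⟨x₀, hx₀⟩ := hc.nonempty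
  have hq := h'.regular_q.add_smul hΩ h.regular_q (-1)
  have hline : ∀ {p : ScalarField}, PressureRegular Ω τ p →
      ContinuousOn (fun y : ℝ × Space => p y.1 x₀) (closedCylinder Ω τ) := fun hp =>
    hp.continuousOn.comp (f := fun y : ℝ × Space => (y.1, x₀)) (by fun_prop)
      fun y hy => ⟨hy.1, subset_closure hx₀⟩
  -- Evaluation at a fixed interior point makes the time function continuous on the closed interval,
  -- so the identity extends from the open to the closed cylinder by density.
  refine ⟨fun t => q' t x₀ - q t x₀, eq_on_closedCylinder hτ h'.regular_q.continuousOn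
    (ψ := fun t x => q t x + (q' t x₀ - q t x₀))
    (h.regular_q.continuousOn.add ((hline h'.regular_q).sub (hline h.regular_q)))
    fun t ht x hx => ?_⟩
  have hdx : ∀ j, ∀ x ∈ Ω, dx j (q' + (-1 : ℝ) • q) t x = 0 := by
    intro i x hx
    have e1 := (momentum_iff (fun j => (h.regular_v j).interiorC1.differentiableAt hΩ ht hx)
      (h.regular_q.interiorC1.differentiableAt hΩ ht hx)).mp (h.momentum i t ht x hx)
    have e2 := (momentum_iff (fun j => (h'.regular_v j).interiorC1.differentiableAt hΩ ht hx)
      (h'.regular_q.interiorC1.differentiableAt hΩ ht hx)).mp (h'.momentum i t ht x hx)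
    have d1 : ∀ i j, dx j (v' i) t x = dx j (v i) t x := fun i j => dx_congr hΩ (hv i t ht) j hx
    have d2 : dt (v' i) t x = dt (v i) t x := dt_congr ht fun r hr => hv i r hr x hx
    have d3 : laplacian (v' i) t x = laplacian (v i) t x :=
      Finset.sum_congr rfl fun j _ => dx_congr hΩ (fun y hy => dx_congr hΩ (hv i t ht) j hy) j hx
    simp only [d1, d2, d3, hv _ t ht x hx] at e2
    rw [dx_add_smul (h'.regular_q.interiorC1.differentiableAt hΩ ht hx)
      (h.regular_q.interiorC1.differentiableAt hΩ ht hx)]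
    linarith
  have : q' t x + (-1) * q t x = q' t x₀ + (-1) * q t x₀ :=
    hq.eq_of_dx_eq_zero hΩ hc ht hdx hx hx₀
  linarith

/-- Where `u = w` and `p = r`, the two antisymmetric halves of the Lagrangian cancel pointwise. -/
theorem IsStationaryPoint.J_eq_zero (hz : IsStationaryPoint Ω ν τ f g z) (hΩ : IsOpen Ω)
    (hc : IsConnected Ω) (hb : Bornology.IsBounded Ω) (hν : 0 < ν) (hτ : 0 < τ) :
    J Ω ν τ z = 0 := by
  rw [J_eq_setIntegral hΩ hb hτ (hz.1.extends_lagrangian ν)]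
  refine setIntegral_eq_zero_of_forall_eq_zero fun y hy => ?_
  have hE := hz.eulerLagrange hΩ hb hτ
  have h := hE.u_eq_w hΩ hb hν hz.1
  have e1 : ∀ i j, dx j (z.w i) y.1 y.2 = dx j (z.u i) y.1 y.2 := fun i j =>
    dx_congr hΩ (fun x hx => (h i y.1 hy.1 x hx).symm) j hy.2
  have e2 : ∀ i, dt (z.w i) y.1 y.2 = dt (z.u i) y.1 y.2 := fun i =>
    dt_congr hy.1 fun r hr => (h i r hr y.2 hy.2).symm
  have e3 : ∀ j, dx j z.r y.1 y.2 = dx j z.p y.1 y.2 := fun j =>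
    dx_congr hΩ (fun x hx => (hE.p_eq_r hΩ hc hb hz.1 h y.1 hy.1 x hx).symm) j hy.2
  simp only [lagrangian_eq, halfLagrangian, e1, e2, e3, ← h _ y.1 hy.1 y.2 hy.2, sub_self]

/-! ### Neither maximum nor minimum -/

/-- There is a test function whose derivative in a given spatial direction has positive `L²` norm. -/
theorem exists_testFunction_integral_sq_pos (hΩ : IsOpen Ω) (hne : Ω.Nonempty)
    (hb : Bornology.IsBounded Ω) (hτ : 0 < τ) (j : Fin 3) :
    ∃ θ, IsTestFunction Ω τ θ ∧
      0 < ∫ y in openCylinder Ω τ, dx j (ofSpaceTime θ) y.1 y.2 ^ 2 := by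
  obtain ⟨x₀, hx₀⟩ := hne
  have hU := isOpen_openCylinder (τ := τ) hΩ
  have hy₀ : (τ / 2, x₀) ∈ openCylinder Ω τ := ⟨⟨by linarith, by linarith⟩, hx₀⟩
  obtain ⟨θ, hs, hcs, hsm, -, h1⟩ :=
    exists_contDiff_tsupport_subset (n := (⊤ : ℕ∞)) (hU.mem_nhds hy₀)
  have hθ : IsTestFunction Ω τ θ := ⟨hsm, hs⟩
  refine ⟨θ, hθ, ?_⟩
  have hdif : Differentiable ℝ θ := hsm.differentiable (by simp)
  have hext : ExtendsContinuously Ω τ fun t x => dx j (ofSpaceTime θ) t x ^ 2 :=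
    ((velocityRegular_ofSpaceTime hsm).extends_dx j).pow 2
  have hnn : ∀ y : ℝ × Space, 0 ≤ dx j (ofSpaceTime θ) y.1 y.2 ^ 2 := fun y => sq_nonneg _
  refine lt_of_le_of_ne (integral_nonneg hnn) fun h0 => ?_
  have h2 := (integral_eq_zero_iff_of_nonneg hnn (hext.integrableOn hΩ hb)).mp h0.symm
  have h3 := Measure.eqOn_open_of_ae_eq h2 hU hext.continuousOn continuousOn_const
  set e : ℝ × Space := ((0 : ℝ), EuclideanSpace.single j (1 : ℝ)) with he
  have h4 : ∀ y, fderiv ℝ θ y e = 0 := by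
    intro y
    by_cases hy : y ∈ openCylinder Ω τ
    · have : dx j (ofSpaceTime θ) y.1 y.2 ^ 2 = 0 := h3 hy
      rw [dx_ofSpaceTime hdif] at this
      exact pow_eq_zero_iff two_ne_zero |>.mp this
    · exact (hθ.fderiv_apply e).eq_zero hy
  -- If the derivative vanished identically, `θ` would be constant along the line through `(τ / 2,
  -- x₀)` in direction `e`. It equals `1` at that point and `0` after the line has left the bounded
  -- set.
  have hline : ∀ s : ℝ, HasDerivAt (fun s : ℝ => θ ((τ / 2, x₀) + s • e)) 0 s := fun s => by
    have := (hdif ((τ / 2, x₀) + s • e)).hasFDerivAt.comp_hasDerivAt s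
      (((hasDerivAt_id s).smul_const e).const_add (τ / 2, x₀))
    refine this.congr_deriv ?_
    simpa using h4 _
  obtain ⟨R, hR⟩ := hb.exists_norm_le
  have hconst := is_const_of_deriv_eq_zero (fun s => (hline s).differentiableAt)
    (fun s => (hline s).deriv) (R + ‖x₀‖ + 1) 0
  have hR0 : 0 ≤ R := (norm_nonneg _).trans (hR x₀ hx₀)
  have hout : (τ / 2, x₀) + (R + ‖x₀‖ + 1) • e ∉ openCylinder Ω τ := by
    intro hmem
    have h5 : ‖x₀ + (R + ‖x₀‖ + 1) • EuclideanSpace.single j (1 : ℝ)‖ ≤ R := hR _ hmem.2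
    have h6 : ‖(R + ‖x₀‖ + 1) • EuclideanSpace.single j (1 : ℝ)‖ = R + ‖x₀‖ + 1 := by
      rw [norm_smul, PiLp.norm_single, norm_one, mul_one, Real.norm_eq_abs,
        abs_of_nonneg (by positivity)]
    have h7 := norm_sub_le (x₀ + (R + ‖x₀‖ + 1) • EuclideanSpace.single j (1 : ℝ)) x₀
    rw [add_sub_cancel_left, h6] at h7
    linarith
  rw [hθ.eq_zero hout, zero_smul, add_zero, h1] at hconst
  exact zero_ne_one hconst

/-- Along suitable lines through a stationary point, `J` is a prescribed multiple of the square of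
the parameter. -/
theorem IsStationaryPoint.exists_variation (hz : IsStationaryPoint Ω ν τ f g z) (hΩ : IsOpen Ω)
    (hne : Ω.Nonempty) (hb : Bornology.IsBounded Ω) (hτ : 0 < τ) (κ : ℝ) :
    ∃ h, AdmissibleVariation Ω τ h ∧ ∀ s : ℝ, J Ω ν τ (z + s • h) = J Ω ν τ z + s ^ 2 * κ := by
  obtain ⟨θ, hθ, hpos⟩ := exists_testFunction_integral_sq_pos hΩ hne hb hτ 0
  set N := ∫ y in openCylinder Ω τ, dx 0 (ofSpaceTime θ) y.1 y.2 ^ 2 with hN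
  have hdif : Differentiable ℝ θ := hθ.contDiff.differentiable (by simp)
  set e : ℝ × Space := ((0 : ℝ), EuclideanSpace.single (0 : Fin 3) (1 : ℝ)) with he
  set a : Fin 3 → ℝ × Space → ℝ := fun i y => if i = 0 then fderiv ℝ θ y e else 0 with ha
  have hat : ∀ i, IsTestFunction Ω τ (a i) := fun i => by
    by_cases h : i = 0
    · simpa [ha, h] using hθ.fderiv_apply e
    · simpa [ha, h] using IsTestFunction.zero
  -- With `δw = 0` and `δr = 0` the cubic coefficient vanishes, and the coupling `δu_i ∂_i δp`
  -- contributes `c (∂₁θ)²` to the quadratic one.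
  set H : ℝ → Fields := fun c => variationOf a (fun y => c * θ y) (fun _ _ => 0) fun _ => 0 with hH
  have hadm : ∀ c, AdmissibleVariation Ω τ (H c) := fun c => admissibleVariation_variationOf hΩ hat
    (hθ.const_mul c) (fun _ => IsTestFunction.zero) IsTestFunction.zero
  have hthird : ∀ c, thirdVariation Ω τ (H c) = 0 := fun c => by
    refine setIntegral_eq_zero_of_forall_eq_zero fun y _ => ?_
    have h0 : ∀ j, dx j (ofSpaceTime fun _ => 0) y.1 y.2 = 0 := fun j => by
      rw [dx_ofSpaceTime (differentiable_const 0)]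
      simp [ofSpaceTime]
    simp [halfLagrangian₃, hH, variationOf, Fields.u, Fields.w, h0, show ∀ t x,
      ofSpaceTime (fun _ => (0 : ℝ)) t x = 0 from fun _ _ => rfl]
  have hsecond : ∀ c, secondVariation Ω ν τ z (H c) = secondVariation Ω ν τ z (H 0) + c * N := by
    intro c
    have i2 := ((extends_halfLagrangian₂ (ν := ν) hz.1.regular_u hz.1.regular_w
      (hadm 0).regular_u (hadm 0).regular_w (hadm 0).regular_p).sub
      (extends_halfLagrangian₂ (ν := ν) hz.1.regular_w hz.1.regular_u
        (hadm 0).regular_w (hadm 0).regular_u (hadm 0).regular_r)).integrableOn hΩ hb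
    have iN := (((velocityRegular_ofSpaceTime (Ω := Ω) (τ := τ) hθ.contDiff).extends_dx 0).pow
      2).integrableOn hΩ hb
    rw [hN, secondVariation, secondVariation, ← integral_const_mul,
      ← integral_add i2 (iN.const_mul c)]
    refine setIntegral_congr_fun (isOpen_openCylinder hΩ).measurableSet fun y _ => ?_
    have hq : ∀ c i, dx i (ofSpaceTime fun y => c * θ y) y.1 y.2 =
        c * dx i (ofSpaceTime θ) y.1 y.2 := fun c i => by
      simp only [dx_ofSpaceTime hdif, dx_ofSpaceTime (hdif.const_mul c), ofSpaceTime]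
      rw [fderiv_const_mul (hdif _)]
      rfl
    have hu : ∀ i, ofSpaceTime (a i) y.1 y.2 =
        if i = 0 then dx 0 (ofSpaceTime θ) y.1 y.2 else 0 := fun i => by
      rw [dx_ofSpaceTime hdif]
      rfl
    simp only [halfLagrangian₂, hH, variationOf, Fields.u, Fields.p, Fields.w, Fields.r, hq]
    simp only [hu, ite_mul, zero_mul, Finset.sum_add_distrib, Finset.sum_ite_eq', Finset.mem_univ,
      if_true]
    ring
  have hfirst : ∀ c, firstVariation Ω ν τ z (H c) = 0 := fun c =>
    (isStationaryPoint_iff_firstVariation hΩ hb hτ ν hz.1).mp hz _ (hadm c)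
  -- The quadratic coefficient is affine in `c` with slope `N > 0`; this `c` makes it equal to `κ`.
  refine ⟨H ((κ - secondVariation Ω ν τ z (H 0)) / N), hadm _, fun s => ?_⟩
  rw [J_add_smul hΩ hb hτ ν hz.1 (hadm _), hfirst, hthird, hsecond, div_mul_cancel₀ _ hpos.ne']
  ring

end

end

end NavierStokesVP

/-! ### The main theorem. -/

theorem mainTheorem1
    (Ω : Set Space) (hΩ_open : IsOpen Ω) (hΩ_conn : IsConnected Ω)
    (hΩ_bdd : Bornology.IsBounded Ω)
    (ν τ : ℝ) (hν : 0 < ν) (hτ : 0 < τ)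
    (f : VectorField) (g : Fin 3 → Space → ℝ) :
    -- on the admissible class, `J` is given by a convergent integral and has a first variation
    (∀ z, Admissible Ω τ f g z →
      IntegrableOn (fun y : ℝ × Space => lagrangian ν z y.1 y.2) (openCylinder Ω τ) ∧
      ∀ h, AdmissibleVariation Ω τ h →
        DifferentiableAt ℝ (fun s : ℝ => J Ω ν τ (z + s • h)) 0) ∧
    -- the stationarity condition is the Euler-Lagrange system
    (∀ z, Admissible Ω τ f g z → (IsStationaryPoint Ω ν τ f g z ↔ EulerLagrange Ω ν τ z)) ∧
    -- at a stationary point the differences `(u - w) / 2` and `(p - r) / 2` vanish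
    (∀ z, IsStationaryPoint Ω ν τ f g z → ∀ t ∈ Icc 0 τ, ∀ x ∈ closure Ω,
      (∀ i, (z.u i t x - z.w i t x) / 2 = 0) ∧ (z.p t x - z.r t x) / 2 = 0) ∧
    -- every stationary point is `(v, q, v, q)` for a Navier-Stokes solution `(v, q)`
    (∀ z, IsStationaryPoint Ω ν τ f g z → ∃ v q, IsNavierStokesSolution Ω ν τ f g v q ∧
      ∀ t ∈ Icc 0 τ, ∀ x ∈ closure Ω,
        (∀ i, z.u i t x = v i t x ∧ z.w i t x = v i t x) ∧
          z.p t x = q t x ∧ z.r t x = q t x) ∧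
    -- and every Navier-Stokes solution `(v, q)` gives a stationary point `(v, q, v, q)`
    (∀ v q, IsNavierStokesSolution Ω ν τ f g v q → IsStationaryPoint Ω ν τ f g (v, q, v, q)) ∧
    -- the stationary point is unique, the pressures up to a common function of time
    (∀ z z', IsStationaryPoint Ω ν τ f g z → IsStationaryPoint Ω ν τ f g z' →
      ∃ c : ℝ → ℝ, ∀ t ∈ Icc 0 τ, ∀ x ∈ closure Ω,
        (∀ i, z'.u i t x = z.u i t x ∧ z'.w i t x = z.w i t x) ∧
          z'.p t x = z.p t x + c t ∧ z'.r t x = z.r t x + c t) ∧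
    -- the stationary value is zero
    (∀ z, IsStationaryPoint Ω ν τ f g z → J Ω ν τ z = 0) ∧
    -- the stationary point is neither a maximum nor a minimum, not even a local one along lines
    (∀ z, IsStationaryPoint Ω ν τ f g z →
      (∃ h, AdmissibleVariation Ω τ h ∧
        ∀ᶠ s in 𝓝[≠] (0 : ℝ), Admissible Ω τ f g (z + s • h) ∧
          J Ω ν τ z < J Ω ν τ (z + s • h)) ∧
      (∃ h, AdmissibleVariation Ω τ h ∧
        ∀ᶠ s in 𝓝[≠] (0 : ℝ), Admissible Ω τ f g (z + s • h) ∧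
          J Ω ν τ (z + s • h) < J Ω ν τ z)) := by
  have hsq : ∀ᶠ s in 𝓝[≠] (0 : ℝ), 0 < s ^ 2 := by
    filter_upwards [self_mem_nhdsWithin] with s hs
    exact pow_two_pos_of_ne_zero hs
  refine ⟨fun z hz => ⟨(hz.extends_lagrangian ν).integrableOn hΩ_open hΩ_bdd, fun h hh =>
      (hasDerivAt_J hΩ_open hΩ_bdd hτ ν hz hh).differentiableAt⟩,
    fun z hz => isStationaryPoint_iff_eulerLagrange hΩ_open hΩ_bdd hτ hz,
    fun z hz t ht x hx => ⟨fun i => ?_, ?_⟩, fun z hz => ?_,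
    fun v q h => h.isStationaryPoint hΩ_open hΩ_bdd hτ, fun z z' hz hz' => ?_,
    fun z hz => hz.J_eq_zero hΩ_open hΩ_conn hΩ_bdd hν hτ, fun z hz => ⟨?_, ?_⟩⟩
  · rw [hz.u_eq_w hΩ_open hΩ_bdd hν hτ i t ht x hx, sub_self, zero_div]
  · rw [hz.p_eq_r hΩ_open hΩ_conn hΩ_bdd hν hτ t ht x hx, sub_self, zero_div]
  · exact ⟨z.u, z.p, hz.isNavierStokesSolution hΩ_open hΩ_bdd hν hτ, fun t ht x hx =>
      ⟨fun i => ⟨rfl, (hz.u_eq_w hΩ_open hΩ_bdd hν hτ i t ht x hx).symm⟩, rfl,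
        (hz.p_eq_r hΩ_open hΩ_conn hΩ_bdd hν hτ t ht x hx).symm⟩⟩
  · have h := hz.isNavierStokesSolution hΩ_open hΩ_bdd hν hτ
    have h' := hz'.isNavierStokesSolution hΩ_open hΩ_bdd hν hτ
    obtain ⟨c, hc⟩ := h.pressure_unique h' hΩ_open hΩ_conn hΩ_bdd hν hτ
    refine ⟨c, fun t ht x hx => ⟨fun i => ?_, hc t ht x hx, ?_⟩⟩
    · have e := eq_on_closedCylinder hτ (hz'.1.regular_u i).continuousOn
        (hz.1.regular_u i).continuousOn (h.velocity_unique h' hΩ_open hΩ_bdd hν i) t ht x hx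
      rw [← hz.u_eq_w hΩ_open hΩ_bdd hν hτ i t ht x hx,
        ← hz'.u_eq_w hΩ_open hΩ_bdd hν hτ i t ht x hx]
      exact ⟨e, e⟩
    · rw [← hz.p_eq_r hΩ_open hΩ_conn hΩ_bdd hν hτ t ht x hx,
        ← hz'.p_eq_r hΩ_open hΩ_conn hΩ_bdd hν hτ t ht x hx]
      exact hc t ht x hx
  · obtain ⟨h, hh, hJ⟩ := hz.exists_variation hΩ_open hΩ_conn.nonempty hΩ_bdd hτ 1
    refine ⟨h, hh, hsq.mono fun s hs => ⟨hz.1.add_smul hΩ_open hh s, ?_⟩⟩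
    rw [hJ s]
    linarith
  · obtain ⟨h, hh, hJ⟩ := hz.exists_variation hΩ_open hΩ_conn.nonempty hΩ_bdd hτ (-1)
    refine ⟨h, hh, hsq.mono fun s hs => ⟨hz.1.add_smul hΩ_open hh s, ?_⟩⟩
    rw [hJ s]
    linarith
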